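/- Let $\mathbb{H}^2$ be the hyperbolic plane, oriented, represented by the upper half-plane $\{z\in\mathbb{C}:\operatorname{Im} z>0\}$ with the metric $(dx^2+dy^2)/y^2$, and let $UT\mathbb{H}^2$ be its unit tangent bundle. Let $2\le r\le\infty$, let $-\infty\le\kappa_1<\kappa_2\le+\infty$, and let $u,v\in UT\mathbb{H}^2$. Denote by $\mathcal{C}_{\kappa_1}^{\kappa_2}(u,v)$ the set of all regular curves $\gamma\colon[0,1]\to\mathbb{H}^2$ of class $C^r$ whose unit tangent vectors at $t=0$ and $t=1$ are $u$ and $v$ respectively, and whose (signed geodesic) curvature takes values in the open interval $(\kappa_1,\kappa_2)\subset\mathbb{R}$. An argument of a regular curve $\gamma$ is a continuous function $\theta\colon[0,1]\to\mathbb{R}$ such that $\dot\gamma(t)\in\mathbb{C}$ is a positive multiple of $e^{i\theta(t)}$ for all $t$; the total turning of $\gamma$ is $\theta(1)-\theta(0)$. A number $\tau\in\mathbb{R}$ is called valid if $v$ is a positive multiple of $e^{i\tau}u$, when $u$ and $v$ are regarded as vectors in $\mathbb{C}$. The canonical subspaces of $\mathcal{C}_{\kappa_1}^{\kappa_2}(u,v)$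 are the sets $$\mathcal{C}_{\kappa_1}^{\kappa_2}(u,v;\tau)=\{\gamma\in\mathcal{C}_{\kappa_1}^{\kappa_2}(u,v) : \gamma \text{ has total turning } \tau\},$$ one for each valid $\tau$. Two intervals are said to overlap if they intersect but neither is contained in the other. (a) If $(\kappa_1,\kappa_2)$ contains $[-1,1]$, then $\mathcal{C}_{\kappa_1}^{\kappa_2}(u,v;\tau)$ is nonempty for every valid $\tau$. (b) If $(\kappa_1,\kappa_2)$ is contained in $[-1,1]$, then $\mathcal{C}_{\kappa_1}^{\kappa_2}(u,v;\tau)$ is nonempty for at most one valid $\tau$. (c) If $(\kappa_1,\kappa_2)$ overlaps $[-1,1]$ or is disjoint from $[-1,1]$, then $\mathcal{C}_{\kappa_1}^{\kappa_2}(u,v;\tau)$ is nonempty for infinitely many valid $\tau$ and empty for infinitely many valid $\tau$. -/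

import Mathlib

open UpperHalfPlane

noncomputable section

namespace HypCurves

/-! The hyperbolic plane is represented by the half-plane model `ℍ = {z : ℂ | 0 < Im z}`, with the
metric `(dx² + dy²) / y²` and the orientation of `ℂ`; its tangent planes are identified with `ℂ`. -/

/-- The Riemannian metric at `p`: `⟨a, b⟩ = (a₁ b₁ + a₂ b₂) / y²`. -/
def metric (p : ℍ) (a b : ℂ) : ℝ := (a.re * b.re + a.im * b.im) / p.im ^ 2

/-- The Riemannian norm of a tangent vector at `p`. -/
def tangentNorm (p : ℍ) (a : ℂ) : ℝ := √(metric p a a)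

/-- The unit tangent bundle of the hyperbolic plane. -/
@[ext]
structure UnitTangent where
  base : ℍ
  vec : ℂ
  norm_eq_one : tangentNorm base vec = 1

/-- The Christoffel bilinear map of the metric at `p`: the vector with `k`-th component
`∑ Γᵢⱼᵏ aⁱ bʲ`. The non-zero Christoffel symbols of `(dx² + dy²) / y²` are
`Γ₁₂¹ = Γ₂₁¹ = -1 / y`, `Γ₁₁² = 1 / y`, `Γ₂₂² = -1 / y`. -/
def christoffel (p : ℍ) (a b : ℂ) : ℂ :=
  ⟨-(a.re * b.im + a.im * b.re) / p.im, (a.re * b.re - a.im * b.im) / p.im⟩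

/-- A curve `[0,1] → ℍ` as a function of a real variable with values in `ℂ` (constant outside
`[0,1]`; only the values on `[0,1]` are ever used). -/
def toPlane (γ : unitInterval → ℍ) : ℝ → ℂ :=
  Set.IccExtend zero_le_one (fun t : unitInterval => (γ t : ℂ))

/-- The velocity `γ'` (one-sided at the endpoints). -/
def velocity (γ : unitInterval → ℍ) (t : unitInterval) : ℂ :=
  derivWithin (toPlane γ) (Set.Icc 0 1) t

/-- The coordinate acceleration `γ''` (one-sided at the endpoints). -/
def acceleration (γ : unitInterval → ℍ) (t : unitInterval) : ℂ :=
  derivWithin (derivWithin (toPlane γ) (Set.Icc 0 1)) (Set.Icc 0 1) t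

/-- The covariant derivative `Dγ'/dt` of the velocity along the curve. -/
def covariantAcceleration (γ : unitInterval → ℍ) (t : unitInterval) : ℂ :=
  acceleration γ t + christoffel (γ t) (velocity γ t) (velocity γ t)

/-- `γ` is of class `C^r` on `[0,1]`. -/
def IsCr (r : ℕ∞) (γ : unitInterval → ℍ) : Prop :=
  ContDiffOn ℝ r (toPlane γ) (Set.Icc 0 1)

/-- `γ` is regular: its velocity never vanishes. -/
def IsRegular (γ : unitInterval → ℍ) : Prop := ∀ t, velocity γ t ≠ 0

/-- The unit tangent vector `γ' / |γ'|` at `γ t`, as an element of `ℂ`. -/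
def unitTangentVec (γ : unitInterval → ℍ) (t : unitInterval) : ℂ :=
  ((tangentNorm (γ t) (velocity γ t))⁻¹ : ℝ) • velocity γ t

/-- The unit normal vector, i.e. the unit tangent rotated by `+π/2`. -/
def unitNormalVec (γ : unitInterval → ℍ) (t : unitInterval) : ℂ :=
  Complex.I * unitTangentVec γ t

/-- The (signed geodesic) curvature `⟨Dγ'/dt, n⟩ / |γ'|²`. -/
def curvature (γ : unitInterval → ℍ) (t : unitInterval) : ℝ :=
  metric (γ t) (covariantAcceleration γ t) (unitNormalVec γ t) /
    tangentNorm (γ t) (velocity γ t) ^ 2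

/-- `γ` has initial unit tangent `u` and terminal unit tangent `v`. -/
def Joins (γ : unitInterval → ℍ) (u v : UnitTangent) : Prop :=
  (γ 0 = u.base ∧ unitTangentVec γ 0 = u.vec) ∧ (γ 1 = v.base ∧ unitTangentVec γ 1 = v.vec)

/-- The open interval `(κ₁, κ₂)` of real numbers, with possibly infinite ends. -/
def openInterval (κ₁ κ₂ : EReal) : Set ℝ := {x : ℝ | κ₁ < (x : EReal) ∧ (x : EReal) < κ₂}

/-- The set of `C^r` regular curves from `u` to `v` whose curvature takes values in
`(κ₁, κ₂)`. -/
def curveSpace (r : ℕ∞) (κ₁ κ₂ : EReal) (u v : UnitTangent) : Set (unitInterval → ℍ) :=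
  {γ | IsCr r γ ∧ IsRegular γ ∧ Joins γ u v ∧ ∀ t, curvature γ t ∈ openInterval κ₁ κ₂}

/-- `θ` is an argument for `γ`: it is continuous and `γ'` always points in the direction of
`e^{iθ}`. -/
def IsArgument (γ : unitInterval → ℍ) (θ : unitInterval → ℝ) : Prop :=
  Continuous θ ∧
    ∀ t, velocity γ t = ((‖velocity γ t‖ : ℝ) : ℂ) * Complex.exp ((θ t : ℂ) * Complex.I)

/-- `γ` has total turning `τ` (which does not depend on the choice of the argument). -/
def HasTotalTurning (γ : unitInterval → ℍ) (τ : ℝ) : Prop :=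
  ∃ θ : unitInterval → ℝ, IsArgument γ θ ∧ θ 1 - θ 0 = τ

/-- The valid total turnings: those `τ` for which `v` points in the direction of `e^{iτ} u`. -/
def validTurnings (u v : UnitTangent) : Set ℝ :=
  {τ | SameRay ℝ v.vec (Complex.exp ((τ : ℂ) * Complex.I) * u.vec)}

/-- The canonical subspace of curves of total turning `τ`; the canonical subspaces of
`curveSpace r κ₁ κ₂ u v` are those with `τ ∈ validTurnings u v`. -/
def canonicalSubspace (r : ℕ∞) (κ₁ κ₂ : EReal) (u v : UnitTangent) (τ : ℝ) :
    Set (unitInterval → ℍ) :=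
  {γ ∈ curveSpace r κ₁ κ₂ u v | HasTotalTurning γ τ}

/-- Two sets overlap if they intersect but neither is contained in the other one. -/
def Overlap (A B : Set ℝ) : Prop := (A ∩ B).Nonempty ∧ ¬ A ⊆ B ∧ ¬ B ⊆ A

end HypCurves

end

/-!
The proof writes a curve `γ = x + iy` through an argument `θ` of its velocity and its hyperbolic
speed `ρ = |γ'| / y`. Then `x' = ρ y cos θ`, `y' = ρ y sin θ`, and the curvature is
`κ = θ' / ρ + cos θ`; equivalently `θ' = ρ (κ - cos θ)` (`argument_ode`).

*Obstructions.* If `κ > -1`, then `θ' > 0` wherever `cos θ = -1`, so `θ` cannot cross an odd multiple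
of `π` downwards and the total turning exceeds `-2π`; symmetrically for `κ < 1`
(`neg_two_pi_lt_of_canonicalSubspace_nonempty`). If `|κ| < 1`, both barriers are present. The same
differential equation holds after the isometry `z ↦ -1 / (z - ξ)`, which replaces `θ` by
`θ - 2 arg (z - ξ)`. If `ξ` is the ideal point from which `u` points away, then the new
argument starts at `-π/2` modulo `2π` and is trapped in an interval of length `π`. So are all total
turnings from `u` to `v` (`exists_forall_abs_turning_sub_le`), and at most one of them is valid.

*Constructions.* If some `κ` with `|κ| > 1` is allowed, a hyperbolic circle of curvature `κ`, which
is also a Euclidean circle, is run through many times while similarities `w ↦ l w + m` with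
`l` and `m` real slowly carry it from a circle tangent to `u` to one tangent to `v`. As the number
of rounds grows the curvature tends uniformly to `κ`
(`exists_forall_nonempty_of_one_lt`). If all of `[-1, 1]` is allowed, then so is every curve with
`|θ'|` small compared to `ρ`. One prescribes any smooth `θ` with the right end values which pauses in
the directions right, up, left and down, and lengthens the pauses so as to arrive at the base point
of `v` (`canonicalSubspace_nonempty_of_Icc_subset`).
-/

namespace HypCurves

open Set Filter Topology ComplexConjugate

/-! ### Curvature and the differential equation of the argument -/

/-- Geodesic curvature, at height `y`, of a curve with velocity `V` and coordinate
acceleration `A`: the Euclidean curvature multiplied by `y`, plus the cosine of the argument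
of `V`. -/
noncomputable def geodesicCurvature (y : ℝ) (V A : ℂ) : ℝ :=
  y * (conj V * A).im / ‖V‖ ^ 3 + V.re / ‖V‖

lemma tangentNorm_eq (p : ℍ) (a : ℂ) : tangentNorm p a = ‖a‖ / p.im := by
  have hp := p.im_pos
  have : metric p a a = (‖a‖ / p.im) ^ 2 := by
    rw [metric, div_pow, ← Complex.normSq_eq_norm_sq, Complex.normSq_apply]
  rw [tangentNorm, this, Real.sqrt_sq (by positivity)]

lemma curvature_eq (γ : unitInterval → ℍ) (t : unitInterval) (hv : velocity γ t ≠ 0) :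
    curvature γ t = geodesicCurvature (γ t).im (velocity γ t) (acceleration γ t) := by
  have hp := (γ t).im_pos
  have hn : 0 < ‖velocity γ t‖ := norm_pos_iff.2 hv
  have hsq : ‖velocity γ t‖ ^ 2 = (velocity γ t).re ^ 2 + (velocity γ t).im ^ 2 := by
    rw [← Complex.normSq_eq_norm_sq, Complex.normSq_apply]; ring
  simp only [curvature, geodesicCurvature, unitNormalVec, unitTangentVec, covariantAcceleration,
    tangentNorm_eq, metric, christoffel]
  set V := velocity γ t
  set A := acceleration γ t
  set y := (γ t).im
  simp
  field_simp
  rw [hsq]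
  ring

lemma UnitTangent.norm_vec (u : UnitTangent) : ‖u.vec‖ = u.base.im := by
  have h := u.norm_eq_one
  rw [tangentNorm_eq, div_eq_one_iff_eq u.base.im_pos.ne'] at h
  exact h

lemma UnitTangent.vec_eq (u : UnitTangent) :
    u.vec = u.base.im * Complex.exp ((u.vec.arg : ℝ) * Complex.I) := by
  rw [← u.norm_vec, Complex.norm_mul_exp_arg_mul_I]

lemma mem_validTurnings_iff (u v : UnitTangent) (τ : ℝ) :
    τ ∈ validTurnings u v ↔
      v.vec = v.base.im * Complex.exp (((u.vec.arg + τ : ℝ) : ℂ) * Complex.I) := by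
  have hu := u.base.im_pos
  have hu' : (u.base.im : ℂ) ≠ 0 := by exact_mod_cast hu.ne'
  rw [validTurnings, mem_ofPred_eq, sameRay_iff_norm_smul_eq, norm_mul,
    Complex.norm_exp_ofReal_mul_I, one_mul, u.norm_vec, v.norm_vec]
  nth_rewrite 1 [u.vec_eq]
  have : v.base.im • (Complex.exp (τ * Complex.I) *
      (u.base.im * Complex.exp ((u.vec.arg : ℝ) * Complex.I))) =
      u.base.im • (v.base.im * Complex.exp (((u.vec.arg + τ : ℝ) : ℂ) * Complex.I)) := by
    push_cast
    rw [add_mul, Complex.exp_add]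
    simp only [Complex.real_smul]
    ring
  rw [this, smul_right_inj hu.ne']
  exact eq_comm

lemma exists_int_of_mem_validTurnings {u v : UnitTangent} {σ τ : ℝ}
    (hσ : σ ∈ validTurnings u v) (hτ : τ ∈ validTurnings u v) :
    ∃ k : ℤ, σ = τ + k * (2 * Real.pi) := by
  rw [mem_validTurnings_iff] at hσ hτ
  have hv : (v.base.im : ℂ) ≠ 0 := by exact_mod_cast v.base.im_pos.ne'
  have h := mul_left_cancel₀ hv (hσ.symm.trans hτ)
  obtain ⟨k, hk⟩ := Complex.exp_eq_exp_iff_exists_int.1 h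
  refine ⟨k, ?_⟩
  have := congrArg Complex.im hk
  simp at this
  linarith

lemma arg_sub_arg_mem_validTurnings (u v : UnitTangent) (k : ℤ) :
    v.vec.arg - u.vec.arg + k * (2 * Real.pi) ∈ validTurnings u v := by
  rw [mem_validTurnings_iff]
  conv_lhs => rw [v.vec_eq]
  congr 1
  rw [Complex.exp_eq_exp_iff_exists_int]
  refine ⟨-k, ?_⟩
  push_cast
  ring

lemma toPlane_apply (γ : unitInterval → ℍ) (t : unitInterval) : toPlane γ t = γ t := by
  rw [toPlane, IccExtend_of_mem _ _ t.2]

section Regularity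

variable {r : ℕ∞} {γ : unitInterval → ℍ}

lemma hasDerivWithinAt_toPlane (hr : 2 ≤ r) (hγ : IsCr r γ) (t : unitInterval) :
    HasDerivWithinAt (toPlane γ) (velocity γ t) (Icc 0 1) t := by
  have h1 : DifferentiableOn ℝ (toPlane γ) (Icc 0 1) :=
    hγ.differentiableOn (by
      have : r ≠ 0 := by rintro rfl; simp at hr
      exact_mod_cast this)
  exact (h1 t t.2).hasDerivWithinAt

lemma hasDerivWithinAt_derivWithin_toPlane (hr : 2 ≤ r) (hγ : IsCr r γ) (t : unitInterval) :
    HasDerivWithinAt (derivWithin (toPlane γ) (Icc 0 1)) (acceleration γ t) (Icc 0 1) t := by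
  have h2 : ContDiffOn ℝ 2 (toPlane γ) (Icc 0 1) := hγ.of_le (WithTop.coe_le_coe.2 hr)
  have h1 : ContDiffOn ℝ 1 (derivWithin (toPlane γ) (Icc 0 1)) (Icc 0 1) :=
    h2.derivWithin (uniqueDiffOn_Icc zero_lt_one) (by norm_num)
  exact (h1.differentiableOn (by norm_num) t t.2).hasDerivWithinAt

/-- An argument is differentiable, since near each time it is the imaginary part of a branch of
the logarithm of the velocity. -/
lemma hasDerivWithinAt_argument (hr : 2 ≤ r) (hγ : IsCr r γ) (hreg : IsRegular γ)
    {θ : unitInterval → ℝ} (hθ : IsArgument γ θ) (t : unitInterval) :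
    HasDerivWithinAt (IccExtend zero_le_one θ) (acceleration γ t / velocity γ t).im
      (Icc 0 1) t := by
  set Θ := IccExtend (zero_le_one (α := ℝ)) θ with hΘ
  have hcont : Continuous Θ := hθ.1.Icc_extend'
  have hv := hreg t
  have hd := (hasDerivWithinAt_derivWithin_toPlane hr hγ t).div_const (velocity γ t)
  have hone : derivWithin (toPlane γ) (Icc 0 1) t / velocity γ t = 1 := div_self hv
  have hlog := (hd.clog_real (by rw [hone]; exact Complex.one_mem_slitPlane))
  have him := (Complex.imCLM.hasFDerivAt.comp_hasDerivWithinAt (t : ℝ) hlog)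
  rw [hone, div_one] at him
  have hev : ∀ᶠ s in 𝓝 (t : ℝ), Θ s - Θ t ∈ Ioo (-Real.pi) Real.pi := by
    have : Tendsto (fun s => Θ s - Θ t) (𝓝 (t : ℝ)) (𝓝 (Θ t - Θ t)) :=
      (hcont.tendsto _).sub_const _
    rw [sub_self] at this
    exact this (Ioo_mem_nhds (by linarith [Real.pi_pos]) Real.pi_pos)
  have heq : ∀ s ∈ Icc (0 : ℝ) 1, Θ s - Θ t ∈ Ioo (-Real.pi) Real.pi →
      Θ s = (Complex.log (derivWithin (toPlane γ) (Icc 0 1) s / velocity γ t)).im + Θ t := by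
    intro s hs hmem
    have hs1 : derivWithin (toPlane γ) (Icc 0 1) s = velocity γ ⟨s, hs⟩ := rfl
    have hΘs : Θ s = θ ⟨s, hs⟩ := IccExtend_of_mem _ _ hs
    have hΘt : Θ t = θ t := by rw [hΘ, IccExtend_val]
    have hq : velocity γ ⟨s, hs⟩ / velocity γ t =
        ((‖velocity γ ⟨s, hs⟩‖ / ‖velocity γ t‖ : ℝ) : ℂ) *
          Complex.exp (((Θ s - Θ t : ℝ) : ℂ) * Complex.I) := by
      conv_lhs => rw [hθ.2 t, hθ.2 ⟨s, hs⟩]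
      rw [hΘs, hΘt]
      push_cast
      rw [sub_mul, Complex.exp_sub]
      ring
    have hpos : 0 < ‖velocity γ ⟨s, hs⟩‖ / ‖velocity γ t‖ :=
      div_pos (norm_pos_iff.2 (hreg _)) (norm_pos_iff.2 hv)
    rw [Complex.log_im, hs1, hq, Complex.arg_real_mul _ hpos, Complex.arg_exp_mul_I,
      (toIocMod_eq_self _).2 ⟨hmem.1, by linarith [hmem.2]⟩]
    ring
  refine ((him.add_const (Θ t)).congr_of_eventuallyEq ?_ ?_)
  · filter_upwards [self_mem_nhdsWithin, nhdsWithin_le_nhds hev] with s hs hs'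
    exact heq s hs hs'
  · exact heq t t.2 (by rw [sub_self]; exact ⟨by linarith [Real.pi_pos], Real.pi_pos⟩)

/-- In terms of the hyperbolic arc length, `θ' = κ - cos θ`. -/
lemma argument_ode (hreg : IsRegular γ) {θ : unitInterval → ℝ} (hθ : IsArgument γ θ)
    (t : unitInterval) :
    (acceleration γ t / velocity γ t).im =
      ‖velocity γ t‖ / (γ t).im * (curvature γ t - Real.cos (θ t)) := by
  have hp := (γ t).im_pos
  have hn : 0 < ‖velocity γ t‖ := norm_pos_iff.2 (hreg t)
  have hcos : (velocity γ t).re / ‖velocity γ t‖ = Real.cos (θ t) := by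
    rw [div_eq_iff hn.ne']
    conv_lhs => rw [hθ.2 t, Complex.re_ofReal_mul, Complex.exp_ofReal_mul_I_re]
    ring
  rw [curvature_eq γ t (hreg t), geodesicCurvature, hcos, add_sub_cancel_right, div_eq_mul_inv,
    Complex.inv_def, Complex.normSq_eq_norm_sq, ← mul_assoc, Complex.im_mul_ofReal,
    mul_comm (acceleration γ t)]
  field_simp

end Regularity

/-- If `f' > 0` wherever `f = c`, then `f` cannot cross `c` downwards. -/
lemma le_of_deriv_pos_of_eq {f f' : ℝ → ℝ} {c : ℝ}
    (hf : ∀ t ∈ Icc (0 : ℝ) 1, HasDerivWithinAt f (f' t) (Icc 0 1) t) (h0 : c ≤ f 0)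
    (h : ∀ t ∈ Icc (0 : ℝ) 1, f t = c → 0 < f' t) : c ≤ f 1 := by
  refine image_le_of_deriv_right_lt_deriv_boundary' (f := fun _ => c) (f' := fun _ => 0)
    (B := f) (B' := f') (a := 0) (b := 1) continuousOn_const
    (fun x _ => hasDerivWithinAt_const _ _ _) h0 (fun x hx => (hf x hx).continuousWithinAt)
    (fun x hx => ?_) (fun x hx hx' => h x (Ico_subset_Icc_self hx) hx'.symm)
    (right_mem_Icc.2 zero_le_one)
  exact (hf x (Ico_subset_Icc_self hx)).mono_of_mem_nhdsWithin
    (mem_of_superset (Icc_mem_nhdsGE hx.2) (Icc_subset_Icc_left hx.1))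

/-- If `f' < 0` wherever `f = c`, then `f` cannot cross `c` upwards. -/
lemma le_of_deriv_neg_of_eq {f f' : ℝ → ℝ} {c : ℝ}
    (hf : ∀ t ∈ Icc (0 : ℝ) 1, HasDerivWithinAt f (f' t) (Icc 0 1) t) (h0 : f 0 ≤ c)
    (h : ∀ t ∈ Icc (0 : ℝ) 1, f t = c → f' t < 0) : f 1 ≤ c := by
  have := le_of_deriv_pos_of_eq (f := fun t => -f t) (f' := fun t => -f' t) (c := -c)
    (fun t ht => (hf t ht).neg) (by linarith)
    (fun t ht e => by have := h t ht (by linarith); linarith)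
  linarith

/-! ### Restrictions on the total turning -/

section Obstructions

variable {r : ℕ∞} {γ : unitInterval → ℍ}

lemma exists_argument_zero_eq {u v : UnitTangent} (hreg : IsRegular γ) (hj : Joins γ u v)
    {θ : unitInterval → ℝ} (hθ : IsArgument γ θ) :
    ∃ k : ℤ, θ 0 = u.vec.arg + k * (2 * Real.pi) := by
  have hn : 0 < ‖velocity γ 0‖ := norm_pos_iff.2 (hreg 0)
  have h0 := hj.1.2
  rw [unitTangentVec, tangentNorm_eq, inv_div, Complex.real_smul, hθ.2 0, hj.1.1, ← mul_assoc,
    u.vec_eq, Complex.norm_mul, Complex.norm_exp_ofReal_mul_I] at h0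
  have hu : (u.base.im : ℂ) ≠ 0 := by exact_mod_cast u.base.im_pos.ne'
  have hn' : (‖velocity γ 0‖ : ℂ) ≠ 0 := by exact_mod_cast hn.ne'
  simp only [Complex.norm_real, norm_norm, mul_one, Complex.ofReal_div] at h0
  rw [div_mul_cancel₀ _ hn'] at h0
  obtain ⟨k, hk⟩ := Complex.exp_eq_exp_iff_exists_int.1 (mul_left_cancel₀ hu h0)
  refine ⟨k, ?_⟩
  have := congrArg Complex.im hk
  simpa using this

/-- If the curvature exceeds `-1`, then the argument cannot decrease through an odd multiple of
`π`: there the tangent points in the direction of a horocycle of curvature `-1`. -/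
lemma neg_two_pi_lt_of_neg_one_lt_curvature (hr : 2 ≤ r) (hγ : IsCr r γ) (hreg : IsRegular γ)
    (hκ : ∀ t, -1 < curvature γ t) {τ : ℝ} (hτ : HasTotalTurning γ τ) : -(2 * Real.pi) < τ := by
  obtain ⟨θ, hθ, rfl⟩ := hτ
  have hpi := Real.pi_pos
  set k : ℤ := ⌊(θ 0 - Real.pi) / (2 * Real.pi)⌋ with hk
  have hk1 : k * (2 * Real.pi) ≤ θ 0 - Real.pi :=
    (le_div_iff₀ (by positivity)).1 (Int.floor_le _)
  have hk2 : θ 0 - Real.pi < (k + 1) * (2 * Real.pi) :=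
    (div_lt_iff₀ (by positivity)).1 (Int.lt_floor_add_one _)
  have hb := le_of_deriv_pos_of_eq (f := IccExtend zero_le_one θ)
    (f' := IccExtend zero_le_one fun t => (acceleration γ t / velocity γ t).im)
    (c := Real.pi + k * (2 * Real.pi))
    (fun t ht => by
      rw [IccExtend_of_mem _ _ ht]; exact hasDerivWithinAt_argument hr hγ hreg hθ ⟨t, ht⟩)
    (by rw [IccExtend_left]; change _ ≤ θ 0; linarith)
    (fun t ht hc => by
      rw [IccExtend_of_mem _ _ ht] at hc ⊢
      rw [argument_ode hreg hθ, hc, Real.cos_add_int_mul_two_pi, Real.cos_pi]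
      have := hκ ⟨t, ht⟩
      have := (γ ⟨t, ht⟩).im_pos
      have := norm_pos_iff.2 (hreg ⟨t, ht⟩)
      exact mul_pos (by positivity) (by linarith))
  rw [IccExtend_right] at hb
  change _ ≤ θ 1 at hb
  linarith

lemma lt_two_pi_of_curvature_lt_one (hr : 2 ≤ r) (hγ : IsCr r γ) (hreg : IsRegular γ)
    (hκ : ∀ t, curvature γ t < 1) {τ : ℝ} (hτ : HasTotalTurning γ τ) : τ < 2 * Real.pi := by
  obtain ⟨θ, hθ, rfl⟩ := hτ
  have hpi := Real.pi_pos
  set k : ℤ := ⌈θ 0 / (2 * Real.pi)⌉ with hk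
  have hk1 : θ 0 ≤ k * (2 * Real.pi) :=
    (div_le_iff₀ (by positivity)).1 (Int.le_ceil _)
  have hk2 : (k - 1) * (2 * Real.pi) < θ 0 :=
    (lt_div_iff₀ (by positivity)).1 (by linarith [Int.ceil_lt_add_one (θ 0 / (2 * Real.pi))])
  have hb := le_of_deriv_neg_of_eq (f := IccExtend zero_le_one θ)
    (f' := IccExtend zero_le_one fun t => (acceleration γ t / velocity γ t).im)
    (c := k * (2 * Real.pi))
    (fun t ht => by
      rw [IccExtend_of_mem _ _ ht]; exact hasDerivWithinAt_argument hr hγ hreg hθ ⟨t, ht⟩)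
    (by rw [IccExtend_left]; exact hk1)
    (fun t ht hc => by
      rw [IccExtend_of_mem _ _ ht] at hc ⊢
      rw [argument_ode hreg hθ, hc, Real.cos_int_mul_two_pi]
      have := hκ ⟨t, ht⟩
      have := (γ ⟨t, ht⟩).im_pos
      have := norm_pos_iff.2 (hreg ⟨t, ht⟩)
      exact mul_neg_of_pos_of_neg (by positivity) (by linarith))
  rw [IccExtend_right] at hb
  change θ 1 ≤ _ at hb
  linarith

/-- A solution of `f' = ρ (κ - cos f)` with `ρ > 0` and `|κ| < 1` that starts at `-π/2` modulo
`2π` remains in the adjacent half-period, as `cos f = -1` and `cos f = 1` at its two ends. -/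
lemma abs_sub_le_of_ode {f ρ κ : ℝ → ℝ}
    (hf : ∀ t ∈ Icc (0 : ℝ) 1,
      HasDerivWithinAt f (ρ t * (κ t - Real.cos (f t))) (Icc 0 1) t)
    (hρ : ∀ t ∈ Icc (0 : ℝ) 1, 0 < ρ t) (hκ : ∀ t ∈ Icc (0 : ℝ) 1, κ t ∈ Ioo (-1) 1)
    (h0 : Real.sin (f 0) = -1) : |f 1 - f 0| ≤ Real.pi / 2 := by
  have hpi := Real.pi_pos
  have h1 := le_of_deriv_pos_of_eq (c := f 0 - Real.pi / 2) hf (by linarith)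
    (fun t ht hc => by
      rw [hc, Real.cos_sub_pi_div_two, h0]
      exact mul_pos (hρ t ht) (by linarith [(hκ t ht).1]))
  have h2 := le_of_deriv_neg_of_eq (c := f 0 + Real.pi / 2) hf (by linarith)
    (fun t ht hc => by
      rw [hc, Real.cos_add_pi_div_two, h0]
      exact mul_neg_of_pos_of_neg (hρ t ht) (by linarith [(hκ t ht).2]))
  rw [abs_le]
  constructor <;> linarith

/-- The isometry `z ↦ -1 / (z - ξ)` moves the ideal point `ξ` to `∞` and changes the argument of a
tangent vector at `z` from `θ` to `θ - 2 arg (z - ξ)`. This is the resulting correction of the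
differential equation of the argument. -/
lemma cos_sub_two_mul_arg {w : ℂ} (hw : w ≠ 0) (θ : ℝ) :
    Real.cos (θ - 2 * w.arg) =
      Real.cos θ + 2 * w.im * (Complex.exp (θ * Complex.I) / w).im := by
  have hn : 0 < ‖w‖ := norm_pos_iff.2 hw
  have hn' : (‖w‖ : ℂ) ≠ 0 := by exact_mod_cast hn.ne'
  have h1 : w.im = ‖w‖ * Real.sin w.arg := by
    rw [mul_comm, Complex.sin_arg, div_mul_cancel₀ _ hn.ne']
  have h2 : Complex.exp (θ * Complex.I) / w =
      ((‖w‖⁻¹ : ℝ) : ℂ) * Complex.exp (((θ - w.arg : ℝ) : ℂ) * Complex.I) := by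
    conv_lhs => rw [← Complex.norm_mul_exp_arg_mul_I w]
    push_cast
    rw [sub_mul, Complex.exp_sub]
    field_simp
  rw [h2, Complex.im_ofReal_mul, Complex.exp_ofReal_mul_I_im, h1,
    show θ - 2 * w.arg = (θ - w.arg) - w.arg by ring, Real.cos_sub (θ - w.arg)]
  have h3 : Real.cos θ = Real.cos ((θ - w.arg) + w.arg) := by rw [sub_add_cancel]
  rw [h3, Real.cos_add]
  field_simp
  ring

lemma abs_turning_le_of_sin_eq (hr : 2 ≤ r) (hγ : IsCr r γ) (hreg : IsRegular γ)
    (hκ : ∀ t, curvature γ t ∈ Ioo (-1) 1) {θ : unitInterval → ℝ} (hθ : IsArgument γ θ)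
    (h0 : Real.sin (θ 0) = -1) : |θ 1 - θ 0| ≤ Real.pi / 2 := by
  have := abs_sub_le_of_ode (f := IccExtend zero_le_one θ)
    (ρ := IccExtend zero_le_one fun t => ‖velocity γ t‖ / (γ t).im)
    (κ := IccExtend zero_le_one (curvature γ))
    (fun t ht => by
      have := hasDerivWithinAt_argument hr hγ hreg hθ ⟨t, ht⟩
      rw [argument_ode hreg hθ] at this
      rw [IccExtend_of_mem _ θ ht, IccExtend_of_mem _ (curvature γ) ht, IccExtend_of_mem _ _ ht]
      exact this)
    (fun t ht => by
      rw [IccExtend_of_mem _ _ ht]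
      exact div_pos (norm_pos_iff.2 (hreg _)) (γ _).im_pos)
    (fun t ht => by rw [IccExtend_of_mem _ _ ht]; exact hκ _)
    (by rw [IccExtend_left]; exact h0)
  rw [IccExtend_left, IccExtend_right] at this
  exact this

lemma abs_turning_sub_le_of_sin_eq (hr : 2 ≤ r) (hγ : IsCr r γ) (hreg : IsRegular γ)
    (hκ : ∀ t, curvature γ t ∈ Ioo (-1) 1) {θ : unitInterval → ℝ} (hθ : IsArgument γ θ)
    (ξ : ℝ) (h0 : Real.sin (θ 0 - 2 * ((γ 0 : ℂ) - ξ).arg) = -1) :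
    |(θ 1 - 2 * ((γ 1 : ℂ) - ξ).arg) - (θ 0 - 2 * ((γ 0 : ℂ) - ξ).arg)| ≤ Real.pi / 2 := by
  have him : ∀ t, 0 < ((γ t : ℂ) - ξ).im := fun t => by simpa using (γ t).im_pos
  have := abs_sub_le_of_ode
    (f := fun t => IccExtend zero_le_one θ t - 2 * (toPlane γ t - ξ).arg)
    (ρ := IccExtend zero_le_one fun t => ‖velocity γ t‖ / (γ t).im)
    (κ := IccExtend zero_le_one (curvature γ))
    (fun t ht => by
      have hd := hasDerivWithinAt_argument hr hγ hreg hθ ⟨t, ht⟩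
      rw [argument_ode hreg hθ] at hd
      have hz := (hasDerivWithinAt_toPlane hr hγ ⟨t, ht⟩).sub_const (ξ : ℂ)
      have hp := toPlane_apply γ ⟨t, ht⟩
      have hlog := hz.clog_real (Or.inr (by rw [hp]; exact (him _).ne'))
      have ha := Complex.imCLM.hasFDerivAt.comp_hasDerivWithinAt t hlog
      have hall := hd.sub (ha.const_mul 2)
      have hw : ((γ ⟨t, ht⟩ : ℂ) - ξ) ≠ 0 := fun h => by
        have := him ⟨t, ht⟩; rw [h] at this; simp at this
      rw [IccExtend_of_mem _ θ ht, IccExtend_of_mem _ (curvature γ) ht, IccExtend_of_mem _ _ ht]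
      refine (hall.congr_of_mem (fun s _ => ?_) ht).congr_deriv ?_
      · simp [Complex.log_im]
      have hn := norm_pos_iff.2 (hreg ⟨t, ht⟩)
      have hy := (γ ⟨t, ht⟩).im_pos
      have hv : velocity γ ⟨t, ht⟩ / ((γ ⟨t, ht⟩ : ℂ) - ξ) = ((‖velocity γ ⟨t, ht⟩‖ : ℝ) : ℂ) *
          (Complex.exp ((θ ⟨t, ht⟩ : ℂ) * Complex.I) / ((γ ⟨t, ht⟩ : ℂ) - ξ)) := by
        conv_lhs => rw [hθ.2 ⟨t, ht⟩]
        rw [mul_div_assoc]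
      rw [hp, Complex.imCLM_apply]
      rw [hv, cos_sub_two_mul_arg hw, Complex.im_ofReal_mul]
      have : ((γ ⟨t, ht⟩ : ℂ) - ξ).im = (γ ⟨t, ht⟩).im := by simp
      rw [this]
      field_simp
      ring)
    (fun t ht => by
      rw [IccExtend_of_mem _ _ ht]
      exact div_pos (norm_pos_iff.2 (hreg _)) (γ _).im_pos)
    (fun t ht => by rw [IccExtend_of_mem _ _ ht]; exact hκ _)
    (by
      rw [IccExtend_left, toPlane, IccExtend_left]; exact h0)
  simp only [toPlane, IccExtend_left, IccExtend_right] at this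
  exact this

/-- The total turnings of the curves from `u` to `v` with curvature in `(-1, 1)` lie in an interval
of length `π`. To see this, move to `∞` the ideal point `ξ` from which `u` points away; then the
argument starts at `-π/2`, and it is trapped between `-π` and `0`. -/
lemma exists_forall_abs_turning_sub_le (hr : 2 ≤ r) (u v : UnitTangent) :
    ∃ m : ℝ, ∀ γ : unitInterval → ℍ, IsCr r γ → IsRegular γ → Joins γ u v →
      (∀ t, curvature γ t ∈ Ioo (-1) 1) → ∀ τ, HasTotalTurning γ τ →
      |τ - m| ≤ Real.pi / 2 := by
  have hpi := Real.pi_pos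
  set α := u.vec.arg with hα
  rcases eq_or_ne α (-(Real.pi / 2)) with h | h
  · refine ⟨0, ?_⟩
    rintro γ hγ hreg hj hκ _ ⟨θ, hθ, rfl⟩
    rw [sub_zero]
    refine abs_turning_le_of_sin_eq hr hγ hreg hκ hθ ?_
    obtain ⟨k, hk⟩ := exists_argument_zero_eq hreg hj hθ
    rw [hk, Real.sin_add_int_mul_two_pi, ← hα, h, Real.sin_neg, Real.sin_pi_div_two]
  · obtain ⟨A, hA, hs⟩ : ∃ A ∈ Ioo 0 Real.pi, Real.sin (α - 2 * A) = -1 := by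
      have h1 := Complex.neg_pi_lt_arg u.vec
      have h2 := Complex.arg_le_pi u.vec
      rcases lt_or_gt_of_ne h with h | h
      · refine ⟨(α + Real.pi / 2) / 2 + Real.pi, ⟨by linarith, by linarith⟩, ?_⟩
        rw [show α - 2 * ((α + Real.pi / 2) / 2 + Real.pi) =
          -(Real.pi / 2) - 2 * Real.pi by ring, Real.sin_sub_two_pi, Real.sin_neg,
          Real.sin_pi_div_two]
      · refine ⟨(α + Real.pi / 2) / 2, ⟨by linarith, by linarith⟩, ?_⟩
        rw [show α - 2 * ((α + Real.pi / 2) / 2) = -(Real.pi / 2) by ring, Real.sin_neg,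
          Real.sin_pi_div_two]
    have hsin : 0 < Real.sin A := Real.sin_pos_of_pos_of_lt_pi hA.1 hA.2
    -- The line through `u.base` in the direction `e^{iA}` meets the real axis in `ξ`.
    set ξ : ℝ := u.base.re - u.base.im * Real.cos A / Real.sin A with hξ
    have harg : ((u.base : ℂ) - ξ).arg = A := by
      have : (u.base : ℂ) - ξ = ((u.base.im / Real.sin A : ℝ) : ℂ) *
          Complex.exp (A * Complex.I) := by
        apply Complex.ext
        · rw [Complex.re_ofReal_mul, Complex.exp_ofReal_mul_I_re]
          rw [Complex.sub_re, Complex.ofReal_re, hξ]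
          change u.base.re - _ = _
          ring
        · rw [Complex.im_ofReal_mul, Complex.exp_ofReal_mul_I_im]
          simp [hsin.ne']
      rw [this, Complex.arg_real_mul _ (div_pos u.base.im_pos hsin), Complex.arg_exp_mul_I,
        (toIocMod_eq_self _).2 ⟨by linarith [hA.1], by linarith [hA.2]⟩]
    refine ⟨2 * ((v.base : ℂ) - ξ).arg - 2 * A, ?_⟩
    rintro γ hγ hreg hj hκ _ ⟨θ, hθ, rfl⟩
    obtain ⟨k, hk⟩ := exists_argument_zero_eq hreg hj hθ
    have := abs_turning_sub_le_of_sin_eq hr hγ hreg hκ hθ ξ (by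
      rw [hj.1.1, harg, hk, ← hα, add_sub_right_comm, Real.sin_add_int_mul_two_pi, hs])
    rw [hj.1.1, hj.2.1, harg] at this
    convert this using 2
    ring

end Obstructions

/-! ### Curves given by a smooth path in the plane -/

section Construction

variable {r : ℕ∞} {κ₁ κ₂ : EReal} {u v : UnitTangent} {τ : ℝ}

open scoped ContDiff in
/-- The curve is given by a smooth path `z` in the plane with argument `φ`. Its class `C^∞` covers
every `r`. -/
lemma canonicalSubspace_nonempty_of_contDiff {z z' z'' : ℝ → ℂ} {φ : ℝ → ℝ}
    (hz : ContDiff ℝ ∞ z) (h1 : ∀ t, HasDerivAt z (z' t) t) (h2 : ∀ t, HasDerivAt z' (z'' t) t)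
    (him : ∀ t ∈ Icc (0 : ℝ) 1, 0 < (z t).im) (hne : ∀ t ∈ Icc (0 : ℝ) 1, z' t ≠ 0)
    (hφ : ContinuousOn φ (Icc 0 1))
    (harg : ∀ t ∈ Icc (0 : ℝ) 1, z' t = (‖z' t‖ : ℂ) * Complex.exp ((φ t : ℂ) * Complex.I))
    (hz0 : z 0 = u.base) (hz1 : z 1 = v.base) (hφ0 : φ 0 = u.vec.arg)
    (hφ1 : φ 1 = u.vec.arg + τ) (hτ : τ ∈ validTurnings u v)
    (hκ : ∀ t ∈ Icc (0 : ℝ) 1,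
      geodesicCurvature (z t).im (z' t) (z'' t) ∈ openInterval κ₁ κ₂) :
    (canonicalSubspace r κ₁ κ₂ u v τ).Nonempty := by
  let γ : unitInterval → ℍ := fun t => ⟨z t, him t t.2⟩
  have hplane : EqOn (toPlane γ) z (Icc 0 1) := fun t ht => IccExtend_of_mem _ _ ht
  have hu : UniqueDiffOn ℝ (Icc (0 : ℝ) 1) := uniqueDiffOn_Icc zero_lt_one
  have hd1 : EqOn (derivWithin (toPlane γ) (Icc 0 1)) z' (Icc 0 1) := fun t ht => by
    rw [derivWithin_congr hplane (hplane ht)]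
    exact (h1 t).hasDerivWithinAt.derivWithin (hu t ht)
  have hvel : ∀ t, velocity γ t = z' t := fun t => hd1 t.2
  have hacc : ∀ t, acceleration γ t = z'' t := fun t => by
    rw [acceleration, derivWithin_congr hd1 (hd1 t.2)]
    exact (h2 t).hasDerivWithinAt.derivWithin (hu t t.2)
  have hreg : IsRegular γ := fun t => by rw [hvel]; exact hne t t.2
  have hbase : ∀ {w : UnitTangent} {t : unitInterval}, z t = w.base → γ t = w.base :=
    fun h => UpperHalfPlane.ext h
  have hvec : ∀ {w : UnitTangent} {t : unitInterval} {α : ℝ}, z t = w.base → φ t = α →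
      w.vec = w.base.im * Complex.exp ((α : ℂ) * Complex.I) → unitTangentVec γ t = w.vec := by
    intro w t α hzt hφt hw
    have hn : (‖z' t‖ : ℂ) ≠ 0 := by exact_mod_cast (norm_pos_iff.2 (hne t t.2)).ne'
    rw [unitTangentVec, tangentNorm_eq, inv_div, Complex.real_smul, hbase hzt, hvel, hw]
    nth_rewrite 2 [harg t t.2]
    rw [← mul_assoc, Complex.ofReal_div, div_mul_cancel₀ _ hn, hφt]
  refine ⟨γ, ⟨?_, hreg, ⟨⟨hbase hz0, hvec hz0 hφ0 u.vec_eq⟩, hbase hz1,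
    hvec hz1 hφ1 ((mem_validTurnings_iff u v τ).1 hτ)⟩, fun t => ?_⟩, fun t => φ t,
    ⟨hφ.domRestrict, fun t => ?_⟩, ?_⟩
  · exact ((hz.of_le (by exact_mod_cast le_top)).contDiffOn).congr hplane
  · rw [curvature_eq γ t (hreg t), hvel, hacc]
    exact hκ t t.2
  · rw [hvel]
    exact harg t t.2
  · change φ 1 - φ 0 = τ
    rw [hφ0, hφ1]
    ring

end Construction

/-! ### Slowly moved circles -/

section Circles

lemma isOpen_openInterval (κ₁ κ₂ : EReal) : IsOpen (openInterval κ₁ κ₂) :=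
  (isOpen_lt continuous_const continuous_coe_real_ereal).inter
    (isOpen_lt continuous_coe_real_ereal continuous_const)

lemma geodesicCurvature_smul {s τ : ℝ} (hs : s ^ 2 = 1) (hτ : 0 < s * τ) (y : ℝ) (V A : ℂ) :
    geodesicCurvature y (τ * V) (τ ^ 2 * A) = s * geodesicCurvature y V A := by
  have hn : ‖(τ : ℂ) * V‖ = s * τ * ‖V‖ := by
    have : |s| = 1 := by rw [← Real.sqrt_sq_eq_abs, hs, Real.sqrt_one]
    rw [norm_mul, Complex.norm_real, Real.norm_eq_abs, ← abs_of_pos hτ, abs_mul s, this, one_mul]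
  have hc : (conj ((τ : ℂ) * V) * ((τ : ℂ) ^ 2 * A)).im = τ ^ 3 * (conj V * A).im := by
    have : conj ((τ : ℂ) * V) * ((τ : ℂ) ^ 2 * A) = ((τ ^ 3 : ℝ) : ℂ) * (conj V * A) := by
      rw [map_mul, Complex.conj_ofReal]; push_cast; ring
    rw [this, Complex.im_ofReal_mul]
  have h0 : s ≠ 0 := left_ne_zero_of_mul hτ.ne'
  have h0' : τ ≠ 0 := right_ne_zero_of_mul hτ.ne'
  have hs3 : s⁻¹ = s := by rw [inv_eq_iff_eq_inv]; field_simp; linarith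
  have hs4 : (s ^ 3)⁻¹ = s := by rw [← inv_pow, hs3, pow_succ, hs, one_mul]
  rw [geodesicCurvature, geodesicCurvature, hn, hc, Complex.re_ofReal_mul]
  have e1 : y * (τ ^ 3 * (conj V * A).im) / (s * τ * ‖V‖) ^ 3 =
      (s ^ 3)⁻¹ * (y * (conj V * A).im / ‖V‖ ^ 3) := by
    rw [mul_pow, mul_pow]; field_simp
  have e2 : τ * V.re / (s * τ * ‖V‖) = s⁻¹ * (V.re / ‖V‖) := by field_simp
  rw [e1, e2, hs3, hs4]
  ring

/-- A curve with velocity `l ζ` and acceleration `i l ζ` at height `l (κ - Re ζ)`, as on a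
Euclidean circle of radius `|l|` centred at height `l κ`, has geodesic curvature `± κ`. -/
lemma geodesicCurvature_circle {s l : ℝ} (hs : s ^ 2 = 1) (hl : 0 < s * l) (κ : ℝ) {ζ : ℂ}
    (hζ : ‖ζ‖ = 1) :
    s * geodesicCurvature (l * (κ - ζ.re)) (l * ζ) (Complex.I * (l * ζ)) = κ := by
  have hl0 : l ≠ 0 := right_ne_zero_of_mul hl.ne'
  have : (Complex.I * (l * ζ) : ℂ) = (l : ℂ) ^ 2 * (((l⁻¹ : ℝ) : ℂ) * (Complex.I * ζ)) := by
    have : (l : ℂ) ≠ 0 := by exact_mod_cast hl0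
    push_cast; field_simp
  rw [this, geodesicCurvature_smul hs hl, ← mul_assoc, ← sq, hs, one_mul, geodesicCurvature, hζ]
  have : conj ζ * (((l⁻¹ : ℝ) : ℂ) * (Complex.I * ζ)) = ((l⁻¹ : ℝ) : ℂ) * Complex.I := by
    have h := Complex.conj_mul' ζ
    rw [hζ] at h
    calc _ = ((l⁻¹ : ℝ) : ℂ) * Complex.I * (conj ζ * ζ) := by ring
      _ = _ := by rw [h]; simp
  rw [this, Complex.im_ofReal_mul, Complex.I_im]
  field_simp
  ring

lemma continuousAt_geodesicCurvature {X : Type*} [TopologicalSpace X] {y : X → ℝ} {V A : X → ℂ}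
    {x : X} (hy : ContinuousAt y x) (hV : ContinuousAt V x) (hA : ContinuousAt A x)
    (h0 : V x ≠ 0) : ContinuousAt (fun x => geodesicCurvature (y x) (V x) (A x)) x := by
  have hn : ‖V x‖ ≠ 0 := norm_ne_zero_iff.2 h0
  have hc : ContinuousAt (fun x => conj (V x)) x := Complex.continuous_conj.continuousAt.comp hV
  refine ((hy.mul (Complex.continuous_im.continuousAt.comp (hc.mul hA))).div (hV.norm.pow 3)
    (pow_ne_zero _ hn)).add ((Complex.continuous_re.continuousAt.comp hV).div hV.norm hn)

variable {r : ℕ∞} {κ₁ κ₂ : EReal} {u v : UnitTangent}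

open scoped ContDiff in
/-- If `|κ| > 1` for some `κ` in the interval, then every valid total turning of the same sign as
`κ` and large absolute value is attained: run many times along a circle of curvature `κ` while
slowly moving it by similarities `w ↦ l w + m`, with `l` and `m` real. For `κ < 0` the model circle
lies in the lower half-plane and `l` is negative. -/
lemma exists_forall_nonempty_of_one_lt {κ s : ℝ} (hκ : κ ∈ openInterval κ₁ κ₂)
    (hs : s ^ 2 = 1) (hκs : 1 < s * κ) :
    ∃ T : ℝ, ∀ τ ∈ validTurnings u v, T < s * τ → (canonicalSubspace r κ₁ κ₂ u v τ).Nonempty := by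
  set α := u.vec.arg with hα
  set β := v.vec.arg with hβ
  have hs1 : |s| = 1 := by rw [← Real.sqrt_sq_eq_abs, hs, Real.sqrt_one]
  have hpos : ∀ x ∈ Icc (-1 : ℝ) 1, 0 < s * (κ - x) := fun x hx => by
    have : s * x ≤ 1 := by
      calc s * x ≤ |s * x| := le_abs_self _
        _ = |x| := by rw [abs_mul, hs1, one_mul]
        _ ≤ 1 := abs_le.2 hx
    linarith [mul_sub s κ x]
  have hcos : ∀ x, 0 < s * (κ - Real.cos x) :=
    fun x => hpos _ ⟨Real.neg_one_le_cos x, Real.cos_le_one x⟩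
  have hre : ∀ x : ℂ, ‖x‖ = 1 → 0 < s * (κ - x.re) :=
    fun x hx => hpos _ (abs_le.1 (hx ▸ Complex.abs_re_le_norm x))
  have hs0 : s ≠ 0 := by rintro rfl; norm_num at hs
  -- A path from the circle through `u` to the circle through `v`, stationary at both ends.
  set l₀ := u.base.im / (κ - Real.cos α) with hl₀
  set l₁ := v.base.im / (κ - Real.cos β) with hl₁
  have hdiv : ∀ {y x : ℝ}, 0 < y → 0 < s * x → 0 < s * (y / x) := fun {y x} hy hx => by
    have : s * (y / x) = y / (s * x) * s ^ 2 := by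
      have := right_ne_zero_of_mul hx.ne'
      field_simp
    rw [this, hs]
    positivity
  have hl₀s : 0 < s * l₀ := hdiv u.base.im_pos (hcos α)
  have hl₁s : 0 < s * l₁ := hdiv v.base.im_pos (hcos β)
  set m₀ := u.base.re - l₀ * Real.sin α with hm₀
  set m₁ := v.base.re - l₁ * Real.sin β with hm₁
  set p : ℝ → ℝ := fun t => 3 * t ^ 2 - 2 * t ^ 3 with hp
  set p' : ℝ → ℝ := fun t => 6 * t - 6 * t ^ 2 with hp'
  set p'' : ℝ → ℝ := fun t => 6 - 12 * t with hp''
  have hpd : ∀ t, HasDerivAt p (p' t) t := fun t => by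
    have := (((hasDerivAt_id t).pow 2).const_mul 3).sub (((hasDerivAt_id t).pow 3).const_mul 2)
    refine this.congr_deriv ?_
    simp [hp']; ring
  have hpd' : ∀ t, HasDerivAt p' (p'' t) t := fun t => by
    have := ((hasDerivAt_id t).const_mul 6).sub (((hasDerivAt_id t).pow 2).const_mul 6)
    refine this.congr_deriv ?_
    simp [hp'']; ring
  set l : ℝ → ℝ := fun t => l₀ + (l₁ - l₀) * p t with hl
  set m : ℝ → ℝ := fun t => m₀ + (m₁ - m₀) * p t with hm
  have hls : ∀ t ∈ Icc (0 : ℝ) 1, 0 < s * l t := fun t ht => by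
    have h1 : 0 ≤ p t := by
      have : p t = t ^ 2 * (3 - 2 * t) := by simp only [hp]; ring
      rw [this]; exact mul_nonneg (sq_nonneg _) (by linarith [ht.2])
    have h2 : 0 ≤ 1 - p t := by
      have : 1 - p t = (1 - t) ^ 2 * (1 + 2 * t) := by simp only [hp]; ring
      rw [this]; exact mul_nonneg (sq_nonneg _) (by linarith [ht.1])
    have : s * l t = (1 - p t) * (s * l₀) + p t * (s * l₁) := by simp only [hl]; ring
    rw [this]
    rcases h1.eq_or_lt with h | h
    · rw [← h]; simpa using hl₀s
    · have := mul_pos h hl₁s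
      have := mul_nonneg h2 hl₀s.le
      linarith
  -- Velocity divided by `τ` and acceleration divided by `τ ^ 2`, in terms of `h = 1 / τ` and of
  -- `ζ = e^{iθ}`, where `θ` is the argument of the unperturbed circle. At `h = 0` the curvature is `κ`.
  set W : ℂ → ℂ := fun ζ => Complex.I * (κ - ζ) with hW
  set V : ℝ → ℝ → ℂ → ℂ := fun h t ζ =>
    l t * ζ + h * (((l₁ - l₀) * p' t : ℝ) * W ζ + ((m₁ - m₀) * p' t : ℝ)) with hV
  set A : ℝ → ℝ → ℂ → ℂ := fun h t ζ =>
    Complex.I * (l t * ζ) + 2 * h * (((l₁ - l₀) * p' t : ℝ) * ζ) +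
      h ^ 2 * (((l₁ - l₀) * p'' t : ℝ) * W ζ + ((m₁ - m₀) * p'' t : ℝ)) with hA
  have hev : ∀ᶠ h in 𝓝 (0 : ℝ), ∀ x ∈ Icc (0 : ℝ) 1 ×ˢ Metric.sphere (0 : ℂ) 1,
      V h x.1 x.2 / (l x.1 * x.2) ∈ Complex.slitPlane ∧
      s * geodesicCurvature (l x.1 * (κ - x.2.re)) (V h x.1 x.2) (A h x.1 x.2) ∈
        openInterval κ₁ κ₂ := by
    refine (isCompact_Icc.prod (isCompact_sphere _ _)).eventually_forall_of_forall_eventually ?_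
    rintro ⟨t, ζ⟩ ⟨ht, hζ⟩
    have hζ1 : ‖ζ‖ = 1 := by simpa using hζ
    have hζ0 : ζ ≠ 0 := by rintro rfl; simp at hζ1
    have hlt : (l t : ℂ) ≠ 0 := by
      exact_mod_cast right_ne_zero_of_mul (hls t ht).ne'
    have hcV : Continuous fun q : ℝ × ℝ × ℂ => V q.1 q.2.1 q.2.2 := by
      simp only [hV, hW, hl, hp, hp']; fun_prop
    have hcA : Continuous fun q : ℝ × ℝ × ℂ => A q.1 q.2.1 q.2.2 := by
      simp only [hA, hW, hl, hp, hp', hp'']; fun_prop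
    have hcl : Continuous fun q : ℝ × ℝ × ℂ => (l q.2.1 : ℂ) * q.2.2 := by
      simp only [hl, hp]; fun_prop
    have hcy : Continuous fun q : ℝ × ℝ × ℂ => l q.2.1 * (κ - q.2.2.re) := by
      simp only [hl, hp]; fun_prop
    have hV0 : V 0 t ζ = l t * ζ := by simp [hV]
    have hA0 : A 0 t ζ = Complex.I * (l t * ζ) := by simp [hA]
    have hne : (l t : ℂ) * ζ ≠ 0 := mul_ne_zero hlt hζ0
    have c1 : ContinuousAt (fun q : ℝ × ℝ × ℂ => V q.1 q.2.1 q.2.2 / (l q.2.1 * q.2.2))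
        (0, t, ζ) := hcV.continuousAt.div hcl.continuousAt hne
    have c2 : ContinuousAt (fun q : ℝ × ℝ × ℂ => s * geodesicCurvature
        (l q.2.1 * (κ - q.2.2.re)) (V q.1 q.2.1 q.2.2) (A q.1 q.2.1 q.2.2)) (0, t, ζ) :=
      (continuousAt_geodesicCurvature hcy.continuousAt hcV.continuousAt hcA.continuousAt
        (by change V 0 t ζ ≠ 0; rw [hV0]; exact hne)).const_mul s
    refine (c1.eventually_mem (Complex.isOpen_slitPlane.mem_nhds ?_)).and
      (c2.eventually_mem ((isOpen_openInterval _ _).mem_nhds ?_))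
    · change V 0 t ζ / (l t * ζ) ∈ _
      rw [hV0, div_self hne]
      exact Complex.one_mem_slitPlane
    · change s * geodesicCurvature (l t * (κ - ζ.re)) (V 0 t ζ) (A 0 t ζ) ∈ _
      rw [hV0, hA0, geodesicCurvature_circle hs (hls t ht) κ hζ1]
      exact hκ
  -- A total turning `τ` with `|τ| > 1 / ε` makes `h = 1 / τ` small enough.
  obtain ⟨ε, hε, hball⟩ := Metric.eventually_nhds_iff.1 hev
  refine ⟨ε⁻¹, fun τ hτ hT => ?_⟩
  have hsτ : 0 < s * τ := (inv_pos.2 hε).trans hT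
  have hτ0 : τ ≠ 0 := right_ne_zero_of_mul hsτ.ne'
  have hτc : (τ : ℂ) ≠ 0 := by exact_mod_cast hτ0
  have hsmall := hball (y := τ⁻¹) (by
    rw [dist_zero_right, norm_inv, Real.norm_eq_abs]
    have : |τ| = s * τ := by rw [← abs_of_pos hsτ, abs_mul, hs1, one_mul]
    rw [this]
    exact inv_lt_of_inv_lt₀ hε hT)
  set E : ℝ → ℂ := fun t => Complex.exp (((α + τ * t : ℝ) : ℂ) * Complex.I) with hE
  have hE1 : ∀ t, ‖E t‖ = 1 := fun t => Complex.norm_exp_ofReal_mul_I _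
  have hEd : ∀ t, HasDerivAt E (τ * (Complex.I * E t)) t := fun t => by
    have h1 : HasDerivAt (fun t : ℝ => α + τ * t) τ t := by
      simpa using ((hasDerivAt_id t).const_mul τ).const_add α
    have h2 := (h1.ofReal_comp.mul_const Complex.I).cexp
    refine h2.congr_deriv ?_
    simp only [hE]; ring
  have hmem : ∀ t ∈ Icc (0 : ℝ) 1, (t, E t) ∈ Icc (0 : ℝ) 1 ×ˢ Metric.sphere (0 : ℂ) 1 :=
    fun t ht => ⟨ht, by simpa using hE1 t⟩
  have hq : ∀ t ∈ Icc (0 : ℝ) 1, V τ⁻¹ t (E t) / (l t * E t) ∈ Complex.slitPlane :=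
    fun t ht => (hsmall _ (hmem t ht)).1
  have hE0 : ∀ t, E t ≠ 0 := fun t => Complex.exp_ne_zero _
  have hl0 : ∀ t ∈ Icc (0 : ℝ) 1, (l t : ℂ) ≠ 0 := fun t ht => by
    exact_mod_cast right_ne_zero_of_mul (hls t ht).ne'
  have hVq : ∀ t ∈ Icc (0 : ℝ) 1, (τ : ℂ) * V τ⁻¹ t (E t) =
      ((τ * l t : ℝ) : ℂ) * ‖V τ⁻¹ t (E t) / (l t * E t)‖ *
        Complex.exp (((α + τ * t + (V τ⁻¹ t (E t) / (l t * E t)).arg : ℝ) : ℂ) * Complex.I) := by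
    intro t ht
    set q := V τ⁻¹ t (E t) / (l t * E t) with hqdef
    have : V τ⁻¹ t (E t) = l t * E t * q := by
      rw [hqdef, mul_div_cancel₀ _ (mul_ne_zero (hl0 t ht) (hE0 t))]
    rw [this]
    conv_lhs => rw [← Complex.norm_mul_exp_arg_mul_I q]
    rw [Complex.ofReal_add (α + τ * t), add_mul, Complex.exp_add]
    simp only [hE]
    push_cast
    ring
  have hτl : ∀ t ∈ Icc (0 : ℝ) 1, 0 < τ * l t := fun t ht => by
    have : τ * l t = (s * τ) * (s * l t) := by
      calc τ * l t = s ^ 2 * (τ * l t) := by rw [hs, one_mul]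
        _ = _ := by ring
    rw [this]
    exact mul_pos hsτ (hls t ht)
  have hnorm : ∀ t ∈ Icc (0 : ℝ) 1, ‖(τ : ℂ) * V τ⁻¹ t (E t)‖ =
      τ * l t * ‖V τ⁻¹ t (E t) / (l t * E t)‖ := fun t ht => by
    rw [hVq t ht, norm_mul, Complex.norm_exp_ofReal_mul_I, mul_one, norm_mul, Complex.norm_real,
      Complex.norm_real, norm_norm, Real.norm_eq_abs, abs_of_pos (hτl t ht)]
  have hld : ∀ t, HasDerivAt (fun t => (l t : ℂ)) (((l₁ - l₀) * p' t : ℝ) : ℂ) t := fun t =>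
    (((hpd t).const_mul _).const_add _).ofReal_comp
  have hmd : ∀ t, HasDerivAt (fun t => (m t : ℂ)) (((m₁ - m₀) * p' t : ℝ) : ℂ) t := fun t =>
    (((hpd t).const_mul _).const_add _).ofReal_comp
  have hld' : ∀ t, HasDerivAt (fun t => (((l₁ - l₀) * p' t : ℝ) : ℂ))
      (((l₁ - l₀) * p'' t : ℝ) : ℂ) t := fun t => ((hpd' t).const_mul _).ofReal_comp
  have hmd' : ∀ t, HasDerivAt (fun t => (((m₁ - m₀) * p' t : ℝ) : ℂ))
      (((m₁ - m₀) * p'' t : ℝ) : ℂ) t := fun t => ((hpd' t).const_mul _).ofReal_comp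
  have hWd : ∀ t, HasDerivAt (fun t => W (E t)) (τ * E t) t := fun t => by
    refine (((hEd t).const_sub (κ : ℂ)).const_mul Complex.I).congr_deriv ?_
    linear_combination (-(τ : ℂ) * E t) * Complex.I_mul_I
  have hp0 : p 0 = 0 := by simp [hp]
  have hp1 : p 1 = 1 := by norm_num [hp]
  have hp'0 : p' 0 = 0 := by simp [hp']
  have hp'1 : p' 1 = 0 := by norm_num [hp']
  have hWim : ∀ t, (W (E t)).im = κ - (E t).re := fun t => by simp [hW]
  have hzim : ∀ t, ((l t : ℂ) * W (E t) + m t).im = l t * (κ - (E t).re) := fun t => by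
    rw [Complex.add_im, Complex.im_ofReal_mul, hWim, Complex.ofReal_im, add_zero]
  have hWexp : ∀ x : ℝ, W (Complex.exp (x * Complex.I)) =
      ⟨Real.sin x, κ - Real.cos x⟩ := fun x => by
    apply Complex.ext
    · simp [hW, ← Complex.ofReal_sin, ← Complex.ofReal_cos, Complex.exp_mul_I]
    · simp [hW, ← Complex.ofReal_sin, ← Complex.ofReal_cos, Complex.exp_mul_I]
  have hbase : ∀ (w : ℍ) (x : ℝ), ((w.im / (κ - Real.cos x) : ℝ) : ℂ) *
      W (Complex.exp (x * Complex.I)) +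
        ((w.re - w.im / (κ - Real.cos x) * Real.sin x : ℝ) : ℂ) = w := fun w x => by
    rw [hWexp]
    apply Complex.ext
    · rw [Complex.add_re, Complex.re_ofReal_mul, Complex.ofReal_re, add_sub_cancel]; rfl
    · rw [Complex.add_im, Complex.im_ofReal_mul, Complex.ofReal_im, add_zero,
        div_mul_cancel₀ _ (right_ne_zero_of_mul (hcos x).ne')]; rfl
  have hEα : E 0 = Complex.exp (α * Complex.I) := by simp [hE]
  have hEβ : E 1 = Complex.exp (β * Complex.I) := by
    have hv : (v.base.im : ℂ) ≠ 0 := by exact_mod_cast v.base.im_pos.ne'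
    have := ((mem_validTurnings_iff u v τ).1 hτ).symm.trans v.vec_eq
    simpa [hE] using mul_left_cancel₀ hv this
  have hqend : ∀ t ∈ Icc (0 : ℝ) 1, p' t = 0 →
      (V τ⁻¹ t (E t) / (l t * E t)).arg = 0 := fun t ht h0 => by
    have : V τ⁻¹ t (E t) = l t * E t := by simp [hV, h0]
    rw [this, div_self (mul_ne_zero (hl0 t ht) (hE0 t)), Complex.arg_one]
  have hpc : ContDiff ℝ ∞ p := by simp only [hp]; fun_prop
  have hEc : ContDiff ℝ ∞ E := by
    have : ContDiff ℝ ∞ fun t : ℝ => ((α + τ * t : ℝ) : ℂ) :=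
      Complex.ofRealCLM.contDiff.comp
        (contDiff_const.add (contDiff_const.mul contDiff_id))
    exact (this.mul contDiff_const).cexp
  have hEcont : Continuous E := hEc.continuous
  refine canonicalSubspace_nonempty_of_contDiff
    (z := fun t => l t * W (E t) + m t)
    (z' := fun t => τ * V τ⁻¹ t (E t)) (z'' := fun t => (τ : ℂ) ^ 2 * A τ⁻¹ t (E t))
    (φ := fun t => α + τ * t + (V τ⁻¹ t (E t) / (l t * E t)).arg)
    ?_ (fun t => ?_) (fun t => ?_) (fun t ht => ?_) (fun t ht => ?_) ?_ (fun t ht => ?_)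
    ?_ ?_ ?_ ?_ hτ (fun t ht => ?_)
  · have h1 : ContDiff ℝ ∞ fun t : ℝ => (l t : ℂ) :=
      Complex.ofRealCLM.contDiff.comp (contDiff_const.add (contDiff_const.mul hpc))
    have h2 : ContDiff ℝ ∞ fun t : ℝ => (m t : ℂ) :=
      Complex.ofRealCLM.contDiff.comp (contDiff_const.add (contDiff_const.mul hpc))
    exact (h1.mul (contDiff_const.mul (contDiff_const.sub hEc))).add h2
  · refine (((hld t).mul (hWd t)).add (hmd t)).congr_deriv ?_
    simp only [hV]
    push_cast
    field_simp
    ring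
  · have := (((hld t).mul (hEd t)).const_mul (τ : ℂ)).add
      (((hld' t).mul (hWd t)).add (hmd' t))
    refine (this.congr_deriv ?_).congr_of_eventuallyEq (Eventually.of_forall fun t => ?_)
    · simp only [hA]
      push_cast
      field_simp
      ring
    · simp only [hV, Pi.add_apply, Pi.mul_apply]
      push_cast
      field_simp
  · rw [hzim]
    have : l t * (κ - (E t).re) = (s * l t) * (s * (κ - (E t).re)) := by
      calc _ = s ^ 2 * (l t * (κ - (E t).re)) := by rw [hs, one_mul]
        _ = _ := by ring
    rw [this]
    exact mul_pos (hls t ht) (hre _ (hE1 t))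
  · rw [← norm_pos_iff, hnorm t ht]
    exact mul_pos (hτl t ht) (norm_pos_iff.2 (Complex.slitPlane_ne_zero (hq t ht)))
  · refine ContinuousOn.add (by fun_prop) fun t ht => ContinuousAt.continuousWithinAt ?_
    refine (Complex.continuousAt_arg (hq t ht)).comp_of_eq ?_ rfl
    refine ContinuousAt.div ?_ ?_ (mul_ne_zero (hl0 t ht) (hE0 t))
    · exact Continuous.continuousAt (by simp only [hV, hW, hl, hp, hp']; fun_prop)
    · exact Continuous.continuousAt (by simp only [hl, hp]; fun_prop)
  · rw [hnorm t ht]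
    refine (hVq t ht).trans ?_
    push_cast
    ring
  · simp only [hl, hm, hp0, mul_zero, add_zero]
    rw [hEα, hl₀, hm₀]
    exact hbase _ _
  · simp only [hl, hm, hp1, mul_one, add_sub_cancel]
    rw [hEβ, hl₁, hm₁]
    exact hbase _ _
  · simp only [hqend 0 (left_mem_Icc.2 zero_le_one) hp'0, mul_zero, add_zero]
    rfl
  · simp only [hqend 1 (right_mem_Icc.2 zero_le_one) hp'1, mul_one, add_zero]
    rfl
  · rw [hzim, geodesicCurvature_smul hs hsτ]
    exact (hsmall _ (hmem t ht)).2

end Circles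

/-! ### Slowly turning curves -/

section SlowTurning

/-- A smooth step rising from `0` to `1` on the interval `[i/9, (i+1)/9]`. -/
noncomputable def step (i : ℕ) (t : ℝ) : ℝ := Real.smoothTransition (9 * t - i)

open scoped ContDiff in
lemma contDiff_step (i : ℕ) : ContDiff ℝ ∞ (step i) :=
  Real.smoothTransition.contDiff.comp ((contDiff_const.mul contDiff_id).sub contDiff_const)

lemma hasDerivAt_step (i : ℕ) (t : ℝ) : HasDerivAt (step i) (deriv (step i) t) t :=
  ((contDiff_step i).differentiable (by simp) t).hasDerivAt

open scoped ContDiff in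
lemma contDiff_deriv_step (i : ℕ) : ContDiff ℝ ∞ (deriv (step i)) :=
  (contDiff_infty_iff_deriv.1 (contDiff_step i)).2

lemma step_eq_zero {i : ℕ} {t : ℝ} (h : 9 * t ≤ i) : step i t = 0 :=
  Real.smoothTransition.zero_of_nonpos (by linarith)

lemma step_eq_one {i : ℕ} {t : ℝ} (h : (i : ℝ) + 1 ≤ 9 * t) : step i t = 1 :=
  Real.smoothTransition.one_of_one_le (by linarith)

lemma deriv_step_nonneg (i : ℕ) (t : ℝ) : 0 ≤ deriv (step i) t := by
  have : Monotone (step i) := fun a b hab =>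
    Real.smoothTransition.monotone (by linarith)
  exact this.deriv_nonneg

lemma deriv_step_eq_zero_or (i : ℕ) (t : ℝ) :
    deriv (step i) t = 0 ∨ ((i : ℝ) < 9 * t ∧ 9 * t < i + 1) := by
  rcases le_or_gt (9 * t) i with h | h
  · left
    refine IsLocalMin.deriv_eq_zero (Eventually.of_forall fun s => ?_)
    rw [step_eq_zero h]
    exact Real.smoothTransition.nonneg _
  rcases le_or_gt ((i : ℝ) + 1) (9 * t) with h' | h'
  · left
    refine IsLocalMax.deriv_eq_zero (Eventually.of_forall fun s => ?_)
    rw [step_eq_one h']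
    exact Real.smoothTransition.le_one _
  · exact Or.inr ⟨h, h'⟩

lemma exists_deriv_step_pos {i : ℕ} (hi : i ≤ 8) : ∃ c ∈ Icc (0 : ℝ) 1, 0 < deriv (step i) c := by
  obtain ⟨c, hc, h⟩ := exists_hasDerivAt_eq_slope (step i) (deriv (step i)) zero_lt_one
    (contDiff_step i).continuous.continuousOn (fun t _ => hasDerivAt_step i t)
  refine ⟨c, Ioo_subset_Icc_self hc, ?_⟩
  have h8 : (i : ℝ) ≤ 8 := by exact_mod_cast hi
  rw [h, step_eq_one (by linarith), step_eq_zero (by simp)]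
  norm_num

/-- A smooth angle function from `α` to `β` which in between pauses, in this order, at the angles
`0`, `π / 2`, `π`, `3π / 2`. -/
noncomputable def pausingAngle (α β t : ℝ) : ℝ :=
  α * (1 - step 0 t) + Real.pi / 2 * (step 2 t + step 4 t + step 6 t) +
    (β - 3 * (Real.pi / 2)) * step 8 t

open scoped ContDiff in
lemma contDiff_pausingAngle (α β : ℝ) : ContDiff ℝ ∞ (pausingAngle α β) :=
  ((contDiff_const.mul (contDiff_const.sub (contDiff_step 0))).add
    (contDiff_const.mul (((contDiff_step 2).add (contDiff_step 4)).add (contDiff_step 6)))).add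
    (contDiff_const.mul (contDiff_step 8))

lemma pausingAngle_zero (α β : ℝ) : pausingAngle α β 0 = α := by
  have h : ∀ i, step i 0 = 0 := fun i => step_eq_zero (by simp)
  simp [pausingAngle, h]

lemma pausingAngle_one (α β : ℝ) : pausingAngle α β 1 = β := by
  have h : ∀ i ≤ 8, step i 1 = 1 := fun i hi => by
    have : (i : ℝ) ≤ 8 := by exact_mod_cast hi
    exact step_eq_one (by linarith)
  rw [pausingAngle, h 0 (by simp), h 2 (by simp), h 4 (by simp), h 6 (by simp), h 8 (by simp)]
  ring

lemma pausingAngle_pause (α β t : ℝ) (k : ℕ) (hk : k ≤ 3) :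
    deriv (step (2 * k + 1)) t = 0 ∨ pausingAngle α β t = k * (Real.pi / 2) := by
  refine (deriv_step_eq_zero_or (2 * k + 1) t).imp_right ?_
  rintro ⟨h1, h2⟩
  push_cast at h1 h2
  have hk0 : (0 : ℝ) ≤ k := k.cast_nonneg
  have hk3 : (k : ℝ) ≤ 3 := by exact_mod_cast hk
  have h0 : step 0 t = 1 := step_eq_one (by push_cast; linarith)
  have h8 : step 8 t = 0 := step_eq_zero (by push_cast; linarith)
  rw [pausingAngle, h0, h8]
  interval_cases k <;> push_cast at h1 h2
  · rw [step_eq_zero (i := 2) (by push_cast; linarith),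
      step_eq_zero (i := 4) (by push_cast; linarith),
      step_eq_zero (i := 6) (by push_cast; linarith)]
    push_cast; ring
  · rw [step_eq_one (i := 2) (by push_cast; linarith),
      step_eq_zero (i := 4) (by push_cast; linarith),
      step_eq_zero (i := 6) (by push_cast; linarith)]
    push_cast; ring
  · rw [step_eq_one (i := 2) (by push_cast; linarith),
      step_eq_one (i := 4) (by push_cast; linarith),
      step_eq_zero (i := 6) (by push_cast; linarith)]
    push_cast; ring
  · rw [step_eq_one (i := 2) (by push_cast; linarith),
      step_eq_one (i := 4) (by push_cast; linarith),
      step_eq_one (i := 6) (by push_cast; linarith)]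
    push_cast; ring

/-- A curve with argument `θ` and hyperbolic speed `ρ` has curvature `θ' / ρ + cos θ`. -/
lemma geodesicCurvature_polar {y ρ : ℝ} (hy : 0 < y) (hρ : 0 < ρ) (θ a θ' : ℝ) :
    geodesicCurvature y (((ρ * y : ℝ) : ℂ) * Complex.exp (θ * Complex.I))
      ((a + Complex.I * ((ρ * y * θ' : ℝ) : ℂ)) * Complex.exp (θ * Complex.I)) =
      θ' / ρ + Real.cos θ := by
  set σ := ρ * y with hσ
  have hσ0 : 0 < σ := mul_pos hρ hy
  have hn : ‖(σ : ℂ) * Complex.exp (θ * Complex.I)‖ = σ := by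
    rw [norm_mul, Complex.norm_exp_ofReal_mul_I, mul_one, Complex.norm_real, Real.norm_eq_abs,
      abs_of_pos hσ0]
  have hE : conj (Complex.exp (θ * Complex.I)) * Complex.exp (θ * Complex.I) = 1 := by
    rw [Complex.conj_mul', Complex.norm_exp_ofReal_mul_I]; simp
  have hc : conj ((σ : ℂ) * Complex.exp (θ * Complex.I)) *
      ((a + Complex.I * ((σ * θ' : ℝ) : ℂ)) * Complex.exp (θ * Complex.I)) =
      (σ : ℂ) * (a + Complex.I * ((σ * θ' : ℝ) : ℂ)) := by
    rw [map_mul, Complex.conj_ofReal]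
    linear_combination ((σ : ℂ) * (a + Complex.I * ((σ * θ' : ℝ) : ℂ))) * hE
  have him : ((σ : ℂ) * (a + Complex.I * ((σ * θ' : ℝ) : ℂ))).im = σ * (σ * θ') := by
    rw [Complex.im_ofReal_mul, Complex.add_im, Complex.ofReal_im, Complex.im_mul_ofReal,
      Complex.I_im]
    ring
  rw [geodesicCurvature, hn, hc, him, Complex.re_ofReal_mul, Complex.exp_ofReal_mul_I_re]
  rw [hσ]
  field_simp

open scoped ContDiff in
lemma contDiff_integral {f : ℝ → ℝ} (hf : ContDiff ℝ ∞ f) :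
    ContDiff ℝ ∞ fun t => ∫ s in (0 : ℝ)..t, f s := by
  have hd : ∀ t, HasDerivAt (fun t => ∫ s in (0 : ℝ)..t, f s) (f t) t :=
    fun t => hf.continuous.integral_hasStrictDerivAt 0 t |>.hasDerivAt
  rw [contDiff_infty_iff_deriv]
  refine ⟨fun t => (hd t).differentiableAt, ?_⟩
  rw [show deriv (fun t => ∫ s in (0 : ℝ)..t, f s) = f from funext fun t => (hd t).deriv]
  exact hf

variable {r : ℕ∞} {κ₁ κ₂ : EReal} {u v : UnitTangent}

open scoped ContDiff in
/-- If `[-1, 1]` is contained in the interval, then any slowly turning curve is admissible, because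
`κ = θ' / ρ + cos θ` where the speed `ρ` is large. Lengthening the parts on which the curve goes
up or down leads it to the right height, and lengthening the parts on which it goes right or left,
which does not affect the height, leads it to the right end point. -/
lemma canonicalSubspace_nonempty_of_Icc_subset (h : Icc (-1 : ℝ) 1 ⊆ openInterval κ₁ κ₂) {τ : ℝ}
    (hτ : τ ∈ validTurnings u v) : (canonicalSubspace r κ₁ κ₂ u v τ).Nonempty := by
  set α := u.vec.arg with hα
  set θ := pausingAngle α (α + τ) with hθ
  have hθc : ContDiff ℝ ∞ θ := contDiff_pausingAngle _ _
  have hθd : ∀ t, HasDerivAt θ (deriv θ t) t :=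
    fun t => (hθc.differentiable (by simp) t).hasDerivAt
  have hθ'c : ContDiff ℝ ∞ (deriv θ) := (contDiff_infty_iff_deriv.1 hθc).2
  have hsinc : ContDiff ℝ ∞ fun t => Real.sin (θ t) := hθc.sin
  have hcosc : ContDiff ℝ ∞ fun t => Real.cos (θ t) := hθc.cos
  obtain ⟨ε, hε, hthick⟩ := (isCompact_Icc (a := (-1 : ℝ)) (b := 1)).exists_thickening_subset_open
    (isOpen_openInterval κ₁ κ₂) h
  obtain ⟨M, hM⟩ := (isCompact_Icc (a := (0 : ℝ)) (b := 1)).exists_bound_of_continuousOn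
    hθ'c.continuous.continuousOn
  have hM0 : 0 ≤ M := (norm_nonneg _).trans (hM 0 (left_mem_Icc.2 zero_le_one))
  set R := (M + 1) / ε with hR
  have hR0 : 0 < R := by positivity
  set b : ℕ → ℝ → ℝ := fun k => deriv (step (2 * k + 1)) with hb
  have hbc : ∀ k, ContDiff ℝ ∞ (b k) := fun k => contDiff_deriv_step _
  have hb0 : ∀ k t, 0 ≤ b k t := fun k t => deriv_step_nonneg _ _
  have hstep0 : ∀ i, step i 0 = 0 := fun i => step_eq_zero (by simp)
  have hstep1 : ∀ i ≤ 8, step i 1 = 1 := fun i hi => by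
    have : (i : ℝ) ≤ 8 := by exact_mod_cast hi
    exact step_eq_one (by linarith)
  have hpause : ∀ k ≤ 3, ∀ t, b k t = 0 ∨ θ t = k * (Real.pi / 2) :=
    fun k hk t => pausingAngle_pause _ _ t k hk
  have hcos3 : Real.cos (3 * (Real.pi / 2)) = 0 := by
    rw [show 3 * (Real.pi / 2) = Real.pi / 2 + Real.pi by ring, Real.cos_add_pi,
      Real.cos_pi_div_two, neg_zero]
  have hsin3 : Real.sin (3 * (Real.pi / 2)) = -1 := by
    rw [show 3 * (Real.pi / 2) = Real.pi / 2 + Real.pi by ring, Real.sin_add_pi,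
      Real.sin_pi_div_two]
  have e0 : ∀ t, b 0 t * Real.sin (θ t) = 0 ∧ b 0 t * Real.cos (θ t) = b 0 t := fun t => by
    rcases hpause 0 (by simp) t with h | h <;> simp [h]
  have e1 : ∀ t, b 1 t * Real.sin (θ t) = b 1 t ∧ b 1 t * Real.cos (θ t) = 0 := fun t => by
    rcases hpause 1 (by simp) t with h | h <;> simp [h]
  have e2 : ∀ t, b 2 t * Real.sin (θ t) = 0 ∧ b 2 t * Real.cos (θ t) = -b 2 t := fun t => by
    rcases hpause 2 (by simp) t with h | h
    · simp [h]
    · rw [h, show ((2 : ℕ) : ℝ) * (Real.pi / 2) = Real.pi by push_cast; ring]; simp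
  have e3 : ∀ t, b 3 t * Real.sin (θ t) = -b 3 t ∧ b 3 t * Real.cos (θ t) = 0 := fun t => by
    rcases hpause 3 (by simp) t with h | h
    · simp [h]
    · rw [h]; push_cast; rw [hsin3, hcos3]; simp
  -- The vertical pauses are lengthened by `P` and `Q`, which leads to the height of `v`.
  have hsplit : ∀ D c d : ℝ, 0 < c → 0 < d → ∃ P Q : ℝ, 0 ≤ P ∧ 0 ≤ Q ∧ P * c - Q * d = D := by
    intro D c d hc hd
    refine ⟨D⁺ / c, D⁻ / d, div_nonneg (posPart_nonneg D) hc.le,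
      div_nonneg (negPart_nonneg D) hd.le, ?_⟩
    rw [div_mul_cancel₀ _ hc.ne', div_mul_cancel₀ _ hd.ne', posPart_sub_negPart]
  set J : ℝ → ℝ := fun t => ∫ s in (0 : ℝ)..t, Real.sin (θ s) with hJ
  have hJd : ∀ t, HasDerivAt J (Real.sin (θ t)) t :=
    fun t => (hsinc.continuous.integral_hasStrictDerivAt 0 t).hasDerivAt
  obtain ⟨P, Q, hP, hQ, hPQ⟩ := hsplit (Real.log (v.base.im / u.base.im) - R * J 1) 1 1
    zero_lt_one zero_lt_one
  set F : ℝ → ℝ := fun t => R * J t + P * step 3 t - Q * step 7 t with hF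
  have hFc : ContDiff ℝ ∞ F := ((contDiff_const.mul (contDiff_integral hsinc)).add
    (contDiff_const.mul (contDiff_step 3))).sub (contDiff_const.mul (contDiff_step 7))
  have hFd : ∀ t, HasDerivAt F (R * Real.sin (θ t) + P * b 1 t - Q * b 3 t) t := fun t =>
    (((hJd t).const_mul R).add ((hasDerivAt_step 3 t).const_mul P)).sub
      ((hasDerivAt_step 7 t).const_mul Q)
  set y : ℝ → ℝ := fun t => u.base.im * Real.exp (F t) with hy
  have hyc : ContDiff ℝ ∞ y := contDiff_const.mul hFc.exp
  have hy0 : ∀ t, 0 < y t := fun t => mul_pos u.base.im_pos (Real.exp_pos _)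
  -- The horizontal pauses are lengthened by `B` and `C`, which leads to the end point.
  have hint : ∀ k ≤ 3, 0 < ∫ s in (0 : ℝ)..1, b k s * y s := fun k hk => by
    refine intervalIntegral.integral_pos zero_lt_one
      ((hbc k).mul hyc).continuous.continuousOn
      (fun t _ => mul_nonneg (hb0 k t) (hy0 t).le) ?_
    obtain ⟨c, hc, h⟩ := exists_deriv_step_pos (i := 2 * k + 1) (by omega)
    exact ⟨c, hc, mul_pos h (hy0 c)⟩
  obtain ⟨B, C, hB, hC, hBC⟩ := hsplit
    (v.base.re - u.base.re - R * ∫ s in (0 : ℝ)..1, y s * Real.cos (θ s)) _ _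
    (hint 0 (by simp)) (hint 2 (by simp))
  set x : ℝ → ℝ := fun t => u.base.re + (R * (∫ s in (0 : ℝ)..t, y s * Real.cos (θ s)) +
    B * (∫ s in (0 : ℝ)..t, b 0 s * y s) - C * ∫ s in (0 : ℝ)..t, b 2 s * y s) with hx
  have hxc : ContDiff ℝ ∞ x := contDiff_const.add
    (((contDiff_const.mul (contDiff_integral (hyc.mul hcosc))).add
      (contDiff_const.mul (contDiff_integral ((hbc 0).mul hyc)))).sub
      (contDiff_const.mul (contDiff_integral ((hbc 2).mul hyc))))
  set ρ : ℝ → ℝ := fun t => R + B * b 0 t + P * b 1 t + C * b 2 t + Q * b 3 t with hρ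
  have hρc : ContDiff ℝ ∞ ρ := (((contDiff_const.add (contDiff_const.mul (hbc 0))).add
    (contDiff_const.mul (hbc 1))).add (contDiff_const.mul (hbc 2))).add
    (contDiff_const.mul (hbc 3))
  have hRρ : ∀ t, R ≤ ρ t := fun t => by
    have h0 := mul_nonneg hB (hb0 0 t)
    have h1 := mul_nonneg hP (hb0 1 t)
    have h2 := mul_nonneg hC (hb0 2 t)
    have h3 := mul_nonneg hQ (hb0 3 t)
    simp only [hρ]
    linarith
  have hρ0 : ∀ t, 0 < ρ t := fun t => hR0.trans_le (hRρ t)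
  have hyd : ∀ t, HasDerivAt y (ρ t * y t * Real.sin (θ t)) t := fun t => by
    refine ((hFd t).exp.const_mul u.base.im).congr_deriv ?_
    simp only [hρ, hy]
    linear_combination (-(u.base.im * Real.exp (F t))) *
      (B * (e0 t).1 + P * (e1 t).1 + C * (e2 t).1 + Q * (e3 t).1)
  have hxd : ∀ t, HasDerivAt x (ρ t * y t * Real.cos (θ t)) t := fun t => by
    have d1 := ((hyc.mul hcosc).continuous.integral_hasStrictDerivAt 0 t).hasDerivAt
    have d2 := (((hbc 0).mul hyc).continuous.integral_hasStrictDerivAt 0 t).hasDerivAt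
    have d3 := (((hbc 2).mul hyc).continuous.integral_hasStrictDerivAt 0 t).hasDerivAt
    refine ((((d1.const_mul R).add (d2.const_mul B)).sub (d3.const_mul C)).const_add
      u.base.re).congr_deriv ?_
    simp only [hρ]
    linear_combination (-(y t)) *
      (B * (e0 t).2 + P * (e1 t).2 + C * (e2 t).2 + Q * (e3 t).2)
  have hρyc : ContDiff ℝ ∞ fun t => ρ t * y t := hρc.mul hyc
  have hρyd : ∀ t, HasDerivAt (fun t => ρ t * y t) (deriv (fun t => ρ t * y t) t) t :=
    fun t => (hρyc.differentiable (by simp) t).hasDerivAt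
  have hexp : ∀ t, Complex.exp ((θ t : ℂ) * Complex.I) =
      (Real.cos (θ t) : ℂ) + Real.sin (θ t) * Complex.I := fun t => by
    rw [Complex.exp_mul_I, Complex.ofReal_cos, Complex.ofReal_sin]
  have hnorm : ∀ t, ‖((ρ t * y t : ℝ) : ℂ) * Complex.exp ((θ t : ℂ) * Complex.I)‖ = ρ t * y t :=
    fun t => by
      rw [norm_mul, Complex.norm_exp_ofReal_mul_I, mul_one, Complex.norm_real, Real.norm_eq_abs,
        abs_of_pos (mul_pos (hρ0 t) (hy0 t))]
  have him : ∀ t, ((x t : ℂ) + y t * Complex.I).im = y t := fun t => by simp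
  refine canonicalSubspace_nonempty_of_contDiff
    (z := fun t => x t + y t * Complex.I)
    (z' := fun t => ((ρ t * y t : ℝ) : ℂ) * Complex.exp ((θ t : ℂ) * Complex.I))
    (z'' := fun t => (((deriv (fun t => ρ t * y t) t : ℝ) : ℂ) +
      Complex.I * ((ρ t * y t * deriv θ t : ℝ) : ℂ)) * Complex.exp ((θ t : ℂ) * Complex.I))
    (φ := θ) ?_ (fun t => ?_) (fun t => ?_) (fun t _ => ?_) (fun t _ => ?_)
    hθc.continuous.continuousOn (fun t _ => ?_) ?_ ?_ (pausingAngle_zero _ _)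
    (pausingAngle_one _ _) hτ (fun t ht => ?_)
  · exact (Complex.ofRealCLM.contDiff.comp hxc).add
      ((Complex.ofRealCLM.contDiff.comp hyc).mul contDiff_const)
  · refine ((hxd t).ofReal_comp.add ((hyd t).ofReal_comp.mul_const Complex.I)).congr_deriv ?_
    rw [hexp]
    push_cast
    ring
  · refine ((hρyd t).ofReal_comp.mul
      ((hθd t).ofReal_comp.mul_const Complex.I).cexp).congr_deriv ?_
    push_cast
    ring
  · rw [him]
    exact hy0 t
  · rw [← norm_pos_iff, hnorm]
    exact mul_pos (hρ0 t) (hy0 t)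
  · rw [hnorm]
  · have hF0 : F 0 = 0 := by simp [hF, hJ, hstep0]
    apply Complex.ext
    · simp [hx]
    · rw [him]
      simp [hy, hF0]
  · have hF1 : F 1 = Real.log (v.base.im / u.base.im) := by
      simp only [hF, hstep1 3 (by simp), hstep1 7 (by simp)]
      linarith
    apply Complex.ext
    · have : x 1 = v.base.re := by simp only [hx]; linarith
      simp [this]
    · rw [him]
      simp only [hy]
      rw [hF1, Real.exp_log (div_pos v.base.im_pos u.base.im_pos),
        mul_div_cancel₀ _ u.base.im_pos.ne']
      rfl
  · rw [him, geodesicCurvature_polar (hy0 t) (hρ0 t)]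
    refine hthick (Metric.mem_thickening_iff.2
      ⟨Real.cos (θ t), ⟨Real.neg_one_le_cos _, Real.cos_le_one _⟩, ?_⟩)
    rw [Real.dist_eq, add_sub_cancel_right, abs_div, abs_of_pos (hρ0 t), div_lt_iff₀ (hρ0 t)]
    have h1 : |deriv θ t| ≤ M := hM t ht
    have h2 : ε * R = M + 1 := by rw [hR]; field_simp
    have h3 := mul_le_mul_of_nonneg_left (hRρ t) hε.le
    linarith

end SlowTurning

/-! ### The three cases -/

section Cases

variable {r : ℕ∞} {κ₁ κ₂ : EReal} {u v : UnitTangent}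

lemma openInterval_subset_Ioo (h : openInterval κ₁ κ₂ ⊆ Icc (-1 : ℝ) 1) :
    openInterval κ₁ κ₂ ⊆ Ioo (-1 : ℝ) 1 := by
  have := interior_mono h
  rwa [(isOpen_openInterval κ₁ κ₂).interior_eq, interior_Icc] at this

lemma openInterval_nonempty (h : κ₁ < κ₂) : (openInterval κ₁ κ₂).Nonempty := by
  obtain ⟨x, h1, h2⟩ := EReal.lt_iff_exists_real_btwn.1 h
  exact ⟨x, h1, h2⟩

lemma openInterval_of_lt {x c : ℝ} (hx : x ∈ openInterval κ₁ κ₂) (hc : c < x)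
    (hcn : c ∉ openInterval κ₁ κ₂) : ∀ κ ∈ openInterval κ₁ κ₂, c < κ := by
  intro κ hκ
  by_contra! h
  exact hcn ⟨hκ.1.trans_le (EReal.coe_le_coe_iff.2 h), (EReal.coe_lt_coe_iff.2 hc).trans hx.2⟩

lemma openInterval_of_gt {x c : ℝ} (hx : x ∈ openInterval κ₁ κ₂) (hc : x < c)
    (hcn : c ∉ openInterval κ₁ κ₂) : ∀ κ ∈ openInterval κ₁ κ₂, κ < c := by
  intro κ hκ
  by_contra! h
  exact hcn ⟨hx.1.trans (EReal.coe_lt_coe_iff.2 hc), (EReal.coe_le_coe_iff.2 h).trans_lt hκ.2⟩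

/-- If the interval neither contains `[-1, 1]` nor is contained in it, then up to sign it contains
a curvature exceeding `1` and lies in `(-1, ∞)`. -/
lemma exists_sign_of_not_subset (h1 : ¬ openInterval κ₁ κ₂ ⊆ Icc (-1 : ℝ) 1)
    (h2 : ¬ Icc (-1 : ℝ) 1 ⊆ openInterval κ₁ κ₂) :
    ∃ s : ℝ, (s = 1 ∨ s = -1) ∧ (∃ κ ∈ openInterval κ₁ κ₂, 1 < s * κ) ∧
      ∀ κ ∈ openInterval κ₁ κ₂, -1 < s * κ := by
  obtain ⟨x, hx, hx1⟩ := not_subset.1 h1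
  obtain ⟨c, hc1, hc⟩ := not_subset.1 h2
  rw [mem_Icc, not_and_or, not_le, not_le] at hx1
  rcases hx1 with hx1 | hx1
  · refine ⟨-1, Or.inr rfl, ⟨x, hx, by linarith⟩, fun κ hκ => ?_⟩
    have := openInterval_of_gt hx (by linarith [hc1.1]) hc κ hκ
    linarith [hc1.2]
  · refine ⟨1, Or.inl rfl, ⟨x, hx, by linarith⟩, fun κ hκ => ?_⟩
    have := openInterval_of_lt hx (by linarith [hc1.2]) hc κ hκ
    linarith [hc1.1]

/-- Among the valid total turnings there are infinitely many in each direction. -/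
lemma infinite_validTurnings (u v : UnitTangent) {s : ℝ} (hs : s = 1 ∨ s = -1) (T : ℝ) :
    {τ ∈ validTurnings u v | T < s * τ}.Infinite := by
  have hpi := Real.two_pi_pos
  set a := v.vec.arg - u.vec.arg
  have key : ∀ B : ℝ, ∃ k : ℤ, B < s * (a + k * (2 * Real.pi)) := by
    intro B
    obtain ⟨n, hn⟩ := exists_int_gt ((B + |a|) / (2 * Real.pi))
    rw [div_lt_iff₀ hpi] at hn
    rcases hs with rfl | rfl
    · exact ⟨n, by linarith [neg_abs_le a]⟩
    · refine ⟨-n, ?_⟩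
      push_cast
      linarith [le_abs_self a]
  refine Infinite.of_image (fun τ => s * τ) (infinite_of_not_bddAbove ?_)
  rintro ⟨b, hb⟩
  obtain ⟨k, hk⟩ := key (max T b)
  have := hb ⟨_, ⟨arg_sub_arg_mem_validTurnings u v k, (le_max_left T b).trans_lt hk⟩, rfl⟩
  exact absurd ((le_max_right T b).trans_lt hk) this.not_gt

lemma neg_two_pi_lt_of_canonicalSubspace_nonempty (hr : 2 ≤ r) {s : ℝ} (hs : s = 1 ∨ s = -1)
    (h : ∀ κ ∈ openInterval κ₁ κ₂, -1 < s * κ) {τ : ℝ}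
    (hne : (canonicalSubspace r κ₁ κ₂ u v τ).Nonempty) : -(2 * Real.pi) < s * τ := by
  obtain ⟨γ, ⟨hγ, hreg, -, hκ⟩, hturn⟩ := hne
  rcases hs with rfl | rfl
  · rw [one_mul]
    exact neg_two_pi_lt_of_neg_one_lt_curvature hr hγ hreg
      (fun t => by linarith [h _ (hκ t)]) hturn
  · have := lt_two_pi_of_curvature_lt_one hr hγ hreg (fun t => by linarith [h _ (hκ t)]) hturn
    linarith

lemma subsingleton_of_openInterval_subset_Icc (hr : 2 ≤ r)
    (h : openInterval κ₁ κ₂ ⊆ Icc (-1 : ℝ) 1) :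
    {τ ∈ validTurnings u v | (canonicalSubspace r κ₁ κ₂ u v τ).Nonempty}.Subsingleton := by
  have hpi := Real.pi_pos
  have h' := openInterval_subset_Ioo h
  obtain ⟨m, hm⟩ := exists_forall_abs_turning_sub_le hr u v
  rintro σ ⟨hσ, γ, ⟨hγ, hreg, hj, hκ⟩, ht⟩ τ ⟨hτ, γ', ⟨hγ', hreg', hj', hκ'⟩, ht'⟩
  have h1 := abs_le.1 (hm γ hγ hreg hj (fun t => h' (hκ t)) σ ht)
  have h2 := abs_le.1 (hm γ' hγ' hreg' hj' (fun t => h' (hκ' t)) τ ht')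
  obtain ⟨k, hk⟩ := exists_int_of_mem_validTurnings hσ hτ
  have hk1 : (k : ℝ) < 1 := by
    by_contra! hc
    have := mul_le_mul_of_nonneg_right hc Real.two_pi_pos.le
    linarith [h1.2, h2.1]
  have hk2 : (-1 : ℝ) < k := by
    by_contra! hc
    have := mul_le_mul_of_nonneg_right hc Real.two_pi_pos.le
    linarith [h1.1, h2.2]
  have hk0 : k = 0 := by
    have h3 : k < 1 := by exact_mod_cast hk1
    have h4 : -1 < k := by exact_mod_cast hk2
    omega
  rw [hk, hk0]
  simp

end Cases

end HypCurves

theorem proposition2p7 (r : ℕ∞) (hr : 2 ≤ r) (κ₁ κ₂ : EReal) (hκ : κ₁ < κ₂)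
    (u v : HypCurves.UnitTangent) :
    (Set.Icc (-1 : ℝ) 1 ⊆ HypCurves.openInterval κ₁ κ₂ →
      ∀ τ ∈ HypCurves.validTurnings u v,
        (HypCurves.canonicalSubspace r κ₁ κ₂ u v τ).Nonempty) ∧
    (HypCurves.openInterval κ₁ κ₂ ⊆ Set.Icc (-1 : ℝ) 1 →
      {τ ∈ HypCurves.validTurnings u v |
        (HypCurves.canonicalSubspace r κ₁ κ₂ u v τ).Nonempty}.Subsingleton) ∧
    (HypCurves.Overlap (HypCurves.openInterval κ₁ κ₂) (Set.Icc (-1 : ℝ) 1) ∨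
        Disjoint (HypCurves.openInterval κ₁ κ₂) (Set.Icc (-1 : ℝ) 1) →
      {τ ∈ HypCurves.validTurnings u v |
        (HypCurves.canonicalSubspace r κ₁ κ₂ u v τ).Nonempty}.Infinite ∧
      {τ ∈ HypCurves.validTurnings u v |
        HypCurves.canonicalSubspace r κ₁ κ₂ u v τ = ∅}.Infinite) := by
  refine ⟨fun h τ hτ => HypCurves.canonicalSubspace_nonempty_of_Icc_subset h hτ,
    HypCurves.subsingleton_of_openInterval_subset_Icc hr, fun h => ?_⟩
  have h12 : ¬ HypCurves.openInterval κ₁ κ₂ ⊆ Set.Icc (-1 : ℝ) 1 ∧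
      ¬ Set.Icc (-1 : ℝ) 1 ⊆ HypCurves.openInterval κ₁ κ₂ := by
    rcases h with h | h
    · exact h.2
    · obtain ⟨x, hx⟩ := HypCurves.openInterval_nonempty hκ
      have h0 : (0 : ℝ) ∈ Set.Icc (-1 : ℝ) 1 := by norm_num
      exact ⟨fun hs => Set.disjoint_left.1 h hx (hs hx),
        fun hs => Set.disjoint_left.1 h (hs h0) h0⟩
  obtain ⟨s, hs, ⟨κ, hκ, hsκ⟩, hbound⟩ := HypCurves.exists_sign_of_not_subset h12.1 h12.2
  constructor
  · obtain ⟨T, hT⟩ := HypCurves.exists_forall_nonempty_of_one_lt (r := r) (u := u) (v := v) hκ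
      (by rcases hs with rfl | rfl <;> norm_num) hsκ
    exact (HypCurves.infinite_validTurnings u v hs T).mono fun τ hτ => ⟨hτ.1, hT τ hτ.1 hτ.2⟩
  · have hs' : -s = 1 ∨ -s = -1 := by
      rcases hs with rfl | rfl <;> norm_num
    refine (HypCurves.infinite_validTurnings u v hs' (2 * Real.pi)).mono fun τ hτ => ⟨hτ.1, ?_⟩
    by_contra hne
    have := HypCurves.neg_two_pi_lt_of_canonicalSubspace_nonempty hr hs hbound
      (Set.nonempty_iff_ne_empty.2 hne)
    linarith [hτ.2]
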